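/- **Networks.** A *perfect cylindrical network* $\Gamma$ is a finite directed multigraph without oriented cycles, embedded in an oriented cylinder, such that boundary vertices are univalent, internal vertices are trivalent, and no internal vertex is a source or a sink; all $m$ sources lie on one boundary circle (left) and all $n$ sinks on the other (right). So each internal vertex is *white* (a unique incoming edge) or *black* (a unique outgoing edge). Fix a *cut*: a curve oriented from the left to the right boundary circle, avoiding the vertices and crossing edges transversally. Cutting the cylinder along it gives a rectangle; sources and sinks are numbered $1,\dots,m$ and $1,\dots,n$ from top to bottom along its left and right sides, the cut being the top and bottom side (the orientation of the cylinder being that of the plane). **Double bracket.** Let $\mathbf k=\mathbb C(\lambda,\mu)$ and let $\mathcal C$ be the $\mathbf k$-linear category generated by the free groupoid on $\Gamma$, with composition written as concatenation of paths, $\otimes=\otimes_{\mathbf k}$, and $(f\otimes g)^\tau=g\otimes f$. Choose scalars $w_{12},w_{13},w_{23},b_{12},b_{13},b_{23}\in\mathbf k$ with $$w_{12}+w_{13}-w_{23}=\tfrac12,\qquad b_{12}+b_{13}-b_{23}=-\tfrac12$$ (for instance $w_{12}=\frac12$, $b_{12}=-\frac12$ and all others $0$). At a white vertex $V$ let $x_1,x_2,x_3$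 be the edges in counterclockwise order with the incoming edge $x_3$ last; at a black vertex $V$ let $y_1,y_2,y_3$ be the edges in counterclockwise order with the outgoing edge $y_3$ last. The double bracket $⟦\cdot,\cdot⟧$ on $\mathcal C$ is the $\mathbf k$-bilinear, skew-symmetric ($⟦f,g⟧=-⟦g,f⟧^\tau$) operation satisfying the double Leibniz rules $$⟦fg,h⟧=(1\otimes f)⟦g,h⟧+⟦f,h⟧(g\otimes 1),\qquad ⟦f,gh⟧=(g\otimes1)⟦f,h⟧+⟦f,g⟧(1\otimes h),$$ whose value on a pair of edges is the sum of the contributions of all internal vertices, the nonzero contributions being, up to skew-symmetry, $$⟦x_1,x_2⟧=w_{12}\,x_1\otimes x_2,\quad ⟦x_1,x_3⟧=w_{13}\,x_3x_1\otimes 1_V,\quad ⟦x_2,x_3⟧=w_{23}\,x_3x_2\otimes 1_V,$$ $$⟦y_1,y_2⟧=b_{12}\,y_2\otimes y_1,\quad ⟦y_1,y_3⟧=b_{13}\,1_V\otimes y_1y_3,\quad ⟦y_2,y_3⟧=b_{23}\,1_V\otimes y_2y_3 .$$ **Boundary measurements.** $B(\lambda)$ is the $m\times n$ matrix with entries $$b_{ij}(\lambda)=\sum_{p:i\to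 j}\lambda^{d(p)}\,\mathrm{wt}(p),$$ the sum being over directed paths $p$ from source $i$ to sink $j$, where $\mathrm{wt}(p)\in\mathcal C$ is the product of the edges of $p$ and $d(p)$ is the oriented intersection index of $p$ with the cut (a crossing from the right-hand side to the left-hand side of the cut counts $+1$, the opposite one $-1$). **Matrices.** $\boxtimes$ is the Kronecker product of matrices. For matrices $X,Y$ over $\mathcal C$ put $⟦X,Y⟧=\sum ⟦x_{ij},y_{kl}⟧\,E_{ij}\boxtimes E_{kl}$; $X_L$ and $X_R$ have entries $x_{ij}\otimes1$ and $1\otimes x_{ij}$; $\tau$ acts on matrices over $\mathcal C\otimes\mathcal C$ entrywise; and $$r_n(\lambda,\mu)=\frac12\,\frac{\mu+\lambda}{\mu-\lambda}\sum_{a=1}^nE_{aa}\boxtimes E_{aa}+\frac1{\mu-\lambda}\sum_{1\le i<j\le n}\bigl(\lambda\,E_{ij}\boxtimes E_{ji}+\mu\,E_{ji}\boxtimes E_{ij}\bigr).$$ **Theorem.** For every perfect cylindrical network with $m$ sources and $n$ sinks, $$⟦B(\lambda),B(\mu)⟧=r_m(\lambda,\mu)\bigl(B_L(\lambda)\boxtimes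 B_R(\mu)\bigr)-\Bigl(\bigl(B_L(\lambda)\boxtimes B_R(\mu)\bigr)\,r_n(\lambda,\mu)\Bigr)^\tau .$$ In particular, if $m=n$, then $⟦B(\lambda),B(\mu)⟧=\bigl[r_n(\lambda,\mu),\,B_L(\lambda)\boxtimes B_R(\mu)\bigr]_\tau$, where $[A,B]_\tau=AB-(BA)^\tau$. -/

import Mathlib

open scoped TensorProduct

noncomputable section

/-- The vertices of a network: `m` sources on the left boundary circle, `n` sinks on the right
boundary circle, and the internal vertices `V`. -/
inductive NetVertex (m n : ℕ) (V : Type*) where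
  | source (i : Fin m)
  | inner (v : V)
  | sink (j : Fin n)
  deriving DecidableEq, Fintype

/-- Combinatorial data of a directed multigraph with edge set `E` drawn on a cylinder, together
with a cut.  A half-edge is a pair `(e, b)`: `(e, true)` is the half of `e` at its tail (it also
stands for `e` traversed forwards), `(e, false)` is the half of `e` at its head (and `e` traversed
backwards).

The cylinder is drawn as a rectangle whose top and bottom edges are identified, with the sources on
the left boundary and the sinks on the right one.  Contracting each boundary circle to a point
makes it an oriented sphere.
* `rot` sends a half-edge to the next one in counterclockwise order around its endpoint, where the
  left boundary circle and the right boundary circle each count as one point of the sphere.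
* `cut` lists the half-edges crossed by the cut, a curve from the left to the right boundary
  circle, in the order of crossing; `d ∈ cut` means that the cut passes from the
  left-hand side of `d` to its right-hand side (`d` pointing away from its endpoint).
  Thus `d`, as a direction of travel, passes from the right-hand to the left-hand side of the cut
  (that is, upwards if the cut goes from left to right). -/
structure CylNetwork (m n : ℕ) (V E : Type*) where
  tail : E → NetVertex m n V
  head : E → NetVertex m n V
  rot : Equiv.Perm (E × Bool)
  cut : List (E × Bool)

namespace CylNetwork

/-- The number of cycles of a permutation, fixed points included. -/
def numCycles {X : Type*} (f : Equiv.Perm X) : ℕ :=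
  Nat.card (Quotient (Equiv.Perm.SameCycle.setoid f))

variable {m n : ℕ} {V E : Type*} (Γ : CylNetwork m n V E)

/-- The vertex at which a half-edge is attached. -/
def base (d : E × Bool) : NetVertex m n V := if d.2 then Γ.tail d.1 else Γ.head d.1

/-- The other half of the same edge. -/
def rev : Equiv.Perm (E × Bool) := Equiv.prodCongr (Equiv.refl E) Equiv.boolNot

/-- The cycles of this permutation are the faces (regions) of the drawing: `d` belongs to the face
on the left-hand side of `d`, and `faceRot d` is the next step along the boundary of that face. -/
def faceRot : Equiv.Perm (E × Bool) := Γ.rot⁻¹ * rev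

/-- The number of connected components of the graph in which all the sources are identified with
each other and all the sinks are identified with each other. -/
def numComponents : ℕ :=
  Nat.card (MulAction.orbitRel.Quotient (Subgroup.closure {Γ.rot, rev}) (E × Bool))

/-- Boundary vertices are univalent, with sources on the left and sinks on the right boundary;
internal vertices are trivalent and are neither sources nor sinks. -/
structure IsPerfect : Prop where
  source_univalent : ∀ i, ∃! d, Γ.base d = .source i
  source_out : ∀ i e, Γ.head e ≠ .source i
  sink_univalent : ∀ j, ∃! d, Γ.base d = .sink j
  sink_in : ∀ j e, Γ.tail e ≠ .sink j
  trivalent : ∀ v, Nat.card {d // Γ.base d = .inner v} = 3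
  inner_not_source : ∀ v, ∃ e, Γ.head e = .inner v
  inner_not_sink : ∀ v, ∃ e, Γ.tail e = .inner v

/-- `rot` is the rotation system of an embedding in the cylinder.  The sources are numbered from
top to bottom, which is the clockwise order seen from the contracted left boundary; the sinks are
numbered from top to bottom, which is the counterclockwise order seen from the contracted right
boundary.  The embedding surface is a sphere by Euler's formula
`#vertices - #edges + #faces = 2 * #components`, the two contracted boundary circles
being vertices. -/
structure IsEmbedded [Fintype E] : Prop where
  rot_inner : ∀ d v, Γ.base d = .inner v → Γ.base (Γ.rot d) = .inner v
  rot_inner_cyclic : ∀ d d' v, Γ.base d = .inner v → Γ.base d' = .inner v → Γ.rot.SameCycle d d'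
  rot_source : ∀ d i, Γ.base d = .source i → Γ.base (Γ.rot d) = .source ((finRotate m).symm i)
  rot_sink : ∀ d j, Γ.base d = .sink j → Γ.base (Γ.rot d) = .sink (finRotate n j)
  planar : numCycles Γ.rot + numCycles Γ.faceRot = Fintype.card E + 2 * Γ.numComponents

/-- `Γ.IsDualWalk d l d'`: a curve that starts in the face on the left of `d`, crosses in turn the
half-edges in `l`, each from its left-hand to its right-hand side, and ends in the face on the
left of `d'`. -/
def IsDualWalk : E × Bool → List (E × Bool) → E × Bool → Prop
  | d, [], d' => Γ.faceRot.SameCycle d d'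
  | d, x :: l, d' => Γ.faceRot.SameCycle d x ∧ IsDualWalk (rev x) l d'

/-- The cut leads from the point of the left boundary just above the first source (that is, between
the last and the first source) to the point of the right boundary just above the first sink. -/
def IsCut : Prop :=
  ∀ (i : Fin m) (j : Fin n) (e f : E), i.val = 0 → j.val = 0 →
    Γ.tail e = .source i → Γ.head f = .sink j → Γ.IsDualWalk (e, true) Γ.cut (f, true)

/-- `Γ.IsPath a p b`: the list of edges `p` is a directed path from `a` to `b`. -/
def IsPath : NetVertex m n V → List E → NetVertex m n V → Prop
  | a, [], b => a = b
  | a, e :: p, b => Γ.tail e = a ∧ IsPath (Γ.head e) p b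

/-- There are no oriented cycles. -/
def IsAcyclic : Prop := ∀ a p, Γ.IsPath a p a → p = []

/-- An acyclic perfect cylindrical network with a cut, all sources on the left and all sinks on the
right boundary, numbered from top to bottom starting at the cut. -/
structure IsPerfectCylindrical [Fintype E] : Prop where
  perfect : Γ.IsPerfect
  embedded : Γ.IsEmbedded
  cut : Γ.IsCut
  acyclic : Γ.IsAcyclic

/-! ### The category of paths -/

/-- Generators: identities of the objects, edges, inverses of edges. -/
inductive Gen (m n : ℕ) (V E : Type*) where
  | one (a : NetVertex m n V)
  | edge (e : E)
  | inv (e : E)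

section Algebra

variable (k : Type*) [Field k]

open FreeAlgebra in
/-- The relations of the `k`-linear category generated by the free groupoid on `Γ`, written in the
algebra of all its morphisms (in which non-composable morphisms have product `0`); juxtaposition is
concatenation of paths. -/
inductive Rel [Fintype V] :
    FreeAlgebra k (Gen m n V E) → FreeAlgebra k (Gen m n V E) → Prop
  | one_mul_one (a : NetVertex m n V) : Rel (ι k (.one a) * ι k (.one a)) (ι k (.one a))
  | one_mul_one_of_ne (a b : NetVertex m n V) (h : a ≠ b) : Rel (ι k (.one a) * ι k (.one b)) 0
  | sum_one : Rel (∑ a, ι k (.one a)) 1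
  | one_mul_edge (e : E) : Rel (ι k (.one (Γ.tail e)) * ι k (.edge e)) (ι k (.edge e))
  | edge_mul_one (e : E) : Rel (ι k (.edge e) * ι k (.one (Γ.head e))) (ι k (.edge e))
  | one_mul_inv (e : E) : Rel (ι k (.one (Γ.head e)) * ι k (.inv e)) (ι k (.inv e))
  | inv_mul_one (e : E) : Rel (ι k (.inv e) * ι k (.one (Γ.tail e))) (ι k (.inv e))
  | edge_mul_inv (e : E) : Rel (ι k (.edge e) * ι k (.inv e)) (ι k (.one (Γ.tail e)))
  | inv_mul_edge (e : E) : Rel (ι k (.inv e) * ι k (.edge e)) (ι k (.one (Γ.head e)))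

variable [Fintype V]

/-- The algebra of morphisms of the `k`-linear category `𝒞 = k π₁(Σ, vertices of Γ)`, i.e. of the
free `k`-linear groupoid on `Γ`. -/
def PathAlg : Type _ := RingQuot (Γ.Rel k)

instance : Ring (Γ.PathAlg k) := inferInstanceAs (Ring (RingQuot (Γ.Rel k)))

instance : Algebra k (Γ.PathAlg k) := inferInstanceAs (Algebra k (RingQuot (Γ.Rel k)))

/-- The quotient map from the free algebra. -/
def toAlg : FreeAlgebra k (Gen m n V E) →ₐ[k] Γ.PathAlg k := RingQuot.mkAlgHom k (Γ.Rel k)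

/-- The identity morphism of the object `a`. -/
def idAt (a : NetVertex m n V) : Γ.PathAlg k :=
  Γ.toAlg k (FreeAlgebra.ι k (.one a))

/-- An edge as a morphism. -/
def arr (e : E) : Γ.PathAlg k :=
  Γ.toAlg k (FreeAlgebra.ι k (.edge e))

/-- The inverse of an edge as a morphism. -/
def arrInv (e : E) : Γ.PathAlg k :=
  Γ.toAlg k (FreeAlgebra.ι k (.inv e))

/-- `τ(f ⊗ g) = g ⊗ f`. -/
def tau : Γ.PathAlg k ⊗[k] Γ.PathAlg k →ₗ[k] Γ.PathAlg k ⊗[k] Γ.PathAlg k :=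
  (TensorProduct.comm k _ _).toLinearMap

open Classical in
/-- `∂_e` on generators, as the off-diagonal entry of a triangular matrix:
`∂_e f = δ_{e f} 1_{s(e)} ⊗ 1_{t(e)}` and `∂_e f⁻¹ = -δ_{e f} f⁻¹ ⊗ f⁻¹`. -/
def partialGen (e : E) :
    Gen m n V E → Matrix (Fin 2) (Fin 2) (Γ.PathAlg k ⊗[k] Γ.PathAlg k)
  | .one a => !![Γ.idAt k a ⊗ₜ 1, 0; 0, 1 ⊗ₜ Γ.idAt k a]
  | .edge f => !![Γ.arr k f ⊗ₜ 1,
      if f = e then Γ.idAt k (Γ.tail f) ⊗ₜ Γ.idAt k (Γ.head f) else 0; 0, 1 ⊗ₜ Γ.arr k f]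
  | .inv f => !![Γ.arrInv k f ⊗ₜ 1,
      if f = e then (-Γ.arrInv k f) ⊗ₜ Γ.arrInv k f else 0; 0, 1 ⊗ₜ Γ.arrInv k f]

variable {k} in
theorem toAlg_rel {x y : FreeAlgebra k (Gen m n V E)} (h : Γ.Rel k x y) :
    Γ.toAlg k x = Γ.toAlg k y :=
  RingQuot.mkAlgHom_rel k h

theorem partialGen_rel (e : E) ⦃x y : FreeAlgebra k (Gen m n V E)⦄ (h : Γ.Rel k x y) :
    FreeAlgebra.lift k (Γ.partialGen k e) x = FreeAlgebra.lift k (Γ.partialGen k e) y := by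
  have h₁ : ∀ a, Γ.idAt k a * Γ.idAt k a = Γ.idAt k a := fun a => by
    simpa only [map_mul, map_sum, map_zero, map_one, idAt] using Γ.toAlg_rel (.one_mul_one a)
  have h₂ : ∀ a b, a ≠ b → Γ.idAt k a * Γ.idAt k b = 0 := fun a b hab => by
    simpa only [map_mul, map_sum, map_zero, map_one, idAt] using Γ.toAlg_rel (.one_mul_one_of_ne a b hab)
  have h₃ : ∑ a, Γ.idAt k a = 1 := by
    simpa only [map_mul, map_sum, map_zero, map_one, idAt] using Γ.toAlg_rel .sum_one
  have h₄ : ∀ f, Γ.idAt k (Γ.tail f) * Γ.arr k f = Γ.arr k f := fun f => by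
    simpa only [map_mul, map_sum, map_zero, map_one, idAt, arr] using Γ.toAlg_rel (.one_mul_edge f)
  have h₅ : ∀ f, Γ.arr k f * Γ.idAt k (Γ.head f) = Γ.arr k f := fun f => by
    simpa only [map_mul, map_sum, map_zero, map_one, idAt, arr] using Γ.toAlg_rel (.edge_mul_one f)
  have h₆ : ∀ f, Γ.idAt k (Γ.head f) * Γ.arrInv k f = Γ.arrInv k f := fun f => by
    simpa only [map_mul, map_sum, map_zero, map_one, idAt, arrInv] using Γ.toAlg_rel (.one_mul_inv f)
  have h₇ : ∀ f, Γ.arrInv k f * Γ.idAt k (Γ.tail f) = Γ.arrInv k f := fun f => by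
    simpa only [map_mul, map_sum, map_zero, map_one, idAt, arrInv] using Γ.toAlg_rel (.inv_mul_one f)
  have h₈ : ∀ f, Γ.arr k f * Γ.arrInv k f = Γ.idAt k (Γ.tail f) := fun f => by
    simpa only [map_mul, map_sum, map_zero, map_one, idAt, arr, arrInv] using Γ.toAlg_rel (.edge_mul_inv f)
  have h₉ : ∀ f, Γ.arrInv k f * Γ.arr k f = Γ.idAt k (Γ.head f) := fun f => by
    simpa only [map_mul, map_sum, map_zero, map_one, idAt, arr, arrInv] using Γ.toAlg_rel (.inv_mul_edge f)
  have hone : (1 : Matrix (Fin 2) (Fin 2) (Γ.PathAlg k ⊗[k] Γ.PathAlg k)) =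
      !![1 ⊗ₜ 1, 0; 0, 1 ⊗ₜ 1] := by
    ext i j; fin_cases i <;> fin_cases j <;> simp [Algebra.TensorProduct.one_def]
  cases h with
  | one_mul_one a => simp [partialGen, h₁]
  | one_mul_one_of_ne a b hab =>
    simp only [map_mul, FreeAlgebra.lift_ι_apply, map_zero, partialGen, Matrix.mul_fin_two]
    ext i j; fin_cases i <;> fin_cases j <;> simp [h₂ a b hab]
  | sum_one =>
    simp only [map_sum, FreeAlgebra.lift_ι_apply, map_one, partialGen, hone]
    ext i j
    rw [Matrix.sum_apply]
    fin_cases i <;> fin_cases j <;>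
      simp [← TensorProduct.sum_tmul, ← TensorProduct.tmul_sum, h₃]
  | one_mul_edge f => by_cases hf : f = e <;> simp [partialGen, h₁, h₄, hf]
  | edge_mul_one f => by_cases hf : f = e <;> simp [partialGen, h₁, h₅, hf]
  | one_mul_inv f => by_cases hf : f = e <;> simp [partialGen, h₆, hf]
  | inv_mul_one f => by_cases hf : f = e <;> simp [partialGen, h₇, hf]
  | edge_mul_inv f =>
    by_cases hf : f = e <;> simp [partialGen, h₆, h₈, hf, TensorProduct.neg_tmul]
  | inv_mul_edge f =>
    by_cases hf : f = e <;> simp [partialGen, h₇, h₉, hf, TensorProduct.neg_tmul]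

/-- The algebra homomorphism `f ↦ !![f ⊗ 1, ∂_e f; 0, 1 ⊗ f]`; its multiplicativity is the Leibniz
rule `∂_e (f g) = (f ⊗ 1) ∂_e g + ∂_e f (1 ⊗ g)`. -/
def partialHom (e : E) :
    Γ.PathAlg k →ₐ[k] Matrix (Fin 2) (Fin 2) (Γ.PathAlg k ⊗[k] Γ.PathAlg k) :=
  RingQuot.liftAlgHom k ⟨FreeAlgebra.lift k (Γ.partialGen k e), Γ.partialGen_rel k e⟩

/-- The double derivation `∂_e = ∂/∂e`. -/
def partialD (e : E) : Γ.PathAlg k →ₗ[k] Γ.PathAlg k ⊗[k] Γ.PathAlg k :=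
  Matrix.entryLinearMap k (Γ.PathAlg k ⊗[k] Γ.PathAlg k) (0 : Fin 2) (1 : Fin 2) ∘ₗ
    (Γ.partialHom k e).toLinearMap

variable {k}

/-- `(x' ⊗ x'') ⊗ (y' ⊗ y'') ↦ (y' ⊗ x') c (x'' ⊗ y'')`. -/
def sandwich (c : Γ.PathAlg k ⊗[k] Γ.PathAlg k) :
    (Γ.PathAlg k ⊗[k] Γ.PathAlg k) ⊗[k] (Γ.PathAlg k ⊗[k] Γ.PathAlg k) →ₗ[k]
      Γ.PathAlg k ⊗[k] Γ.PathAlg k :=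
  LinearMap.mul' k (Γ.PathAlg k ⊗[k] Γ.PathAlg k) ∘ₗ
    TensorProduct.map (LinearMap.mulRight k c ∘ₗ Γ.tau k) LinearMap.id ∘ₗ
    (TensorProduct.tensorTensorTensorComm k (Γ.PathAlg k) (Γ.PathAlg k)
      (Γ.PathAlg k) (Γ.PathAlg k)).toLinearMap

end Algebra

/-- The edges at a white vertex `v` in counterclockwise order, the unique incoming one, `x₃`,
being last. -/
def IsWhite (v : V) (x₁ x₂ x₃ : E) : Prop :=
  Γ.head x₃ = .inner v ∧ Γ.rot (x₃, false) = (x₁, true) ∧ Γ.rot (x₁, true) = (x₂, true) ∧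
    Γ.rot (x₂, true) = (x₃, false)

/-- The edges at a black vertex `v` in counterclockwise order, the unique outgoing one, `y₃`,
being last. -/
def IsBlack (v : V) (y₁ y₂ y₃ : E) : Prop :=
  Γ.tail y₃ = .inner v ∧ Γ.rot (y₃, true) = (y₁, false) ∧ Γ.rot (y₁, false) = (y₂, false) ∧
    Γ.rot (y₂, false) = (y₃, true)

/-- The six parameters of the local brackets at white and black vertices. -/
structure Weights (k : Type*) where
  (w₁₂ w₁₃ w₂₃ b₁₂ b₁₃ b₂₃ : k)

/-- The parameters give the standard bracket, `W = 1/2` and `B = -1/2`, i.e. that of the twisted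
ribbon graph. -/
def Weights.IsStandard {k : Type*} [Field k] (w : Weights k) : Prop :=
  w.w₁₂ + w.w₁₃ - w.w₂₃ = 1 / 2 ∧ w.b₁₂ + w.b₁₃ - w.b₂₃ = -(1 / 2)

section Bracket

variable {k : Type*} [Field k] [Fintype V] [Fintype E] (w : Weights k)

open Classical in
/-- The skew-symmetric function of two edges with value `c` at `(a, b)`. -/
def pairTerm (a b : E) (c : Γ.PathAlg k ⊗[k] Γ.PathAlg k) (e f : E) :
    Γ.PathAlg k ⊗[k] Γ.PathAlg k :=
  (if e = a ∧ f = b then c else 0) - (if e = b ∧ f = a then Γ.tau k c else 0)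

open Classical in
/-- The double bracket of two edges, the sum of the contributions of the internal vertices. -/
def edgeBracket (e f : E) : Γ.PathAlg k ⊗[k] Γ.PathAlg k :=
  ∑ v : V, ∑ x₁ : E, ∑ x₂ : E, ∑ x₃ : E,
    ((if Γ.IsWhite v x₁ x₂ x₃ then
        Γ.pairTerm x₁ x₂ (w.w₁₂ • Γ.arr k x₁ ⊗ₜ Γ.arr k x₂) e f +
        Γ.pairTerm x₁ x₃ (w.w₁₃ • (Γ.arr k x₃ * Γ.arr k x₁) ⊗ₜ Γ.idAt k (.inner v)) e f +
        Γ.pairTerm x₂ x₃ (w.w₂₃ • (Γ.arr k x₃ * Γ.arr k x₂) ⊗ₜ Γ.idAt k (.inner v)) e f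
      else 0) +
     (if Γ.IsBlack v x₁ x₂ x₃ then
        Γ.pairTerm x₁ x₂ (w.b₁₂ • Γ.arr k x₂ ⊗ₜ Γ.arr k x₁) e f +
        Γ.pairTerm x₁ x₃ (w.b₁₃ • Γ.idAt k (.inner v) ⊗ₜ (Γ.arr k x₁ * Γ.arr k x₃)) e f +
        Γ.pairTerm x₂ x₃ (w.b₂₃ • Γ.idAt k (.inner v) ⊗ₜ (Γ.arr k x₂ * Γ.arr k x₃)) e f
      else 0))

/-- The double bracket on `𝒞`: the extension of `edgeBracket` by the double Leibniz identities,
`⟦x, y⟧ = ∑ (y' ⊗ x') ⟦e, f⟧ (x'' ⊗ y'')` over all edges `e`, `f`, where `∂_e x = x' ⊗ x''` and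
`∂_f y = y' ⊗ y''`. -/
def doubleBracket (x y : Γ.PathAlg k) : Γ.PathAlg k ⊗[k] Γ.PathAlg k :=
  ∑ e : E, ∑ f : E, Γ.sandwich (Γ.edgeBracket w e f) (Γ.partialD k e x ⊗ₜ Γ.partialD k f y)

end Bracket

/-! ### Boundary measurements -/

open Classical in
/-- The oriented intersection index of a path with the cut; a crossing from the right-hand to the
left-hand side of the cut counts `+1`. -/
def index (p : List E) : ℤ :=
  (p.map fun e => (Γ.cut.count (e, true) : ℤ) - (Γ.cut.count (e, false) : ℤ)).sum

section Measurement

variable {k : Type*} [Field k] [Fintype V]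

/-- The weight of a path: the product of its edges in `𝒞`. -/
def weight (p : List E) : Γ.PathAlg k := (p.map (Γ.arr k)).prod

/-- The boundary measurement matrix `B(z)`. -/
def boundaryMeasurement (z : k) : Matrix (Fin m) (Fin n) (Γ.PathAlg k) := fun i j =>
  ∑ᶠ p ∈ {p : List E | Γ.IsPath (.source i) p (.sink j)}, z ^ Γ.index p • Γ.weight p

end Measurement

theorem isPath_append {p q : List E} : ∀ {a b : NetVertex m n V},
    Γ.IsPath a (p ++ q) b → ∃ c, Γ.IsPath a p c ∧ Γ.IsPath c q b := by
  induction p with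
  | nil => intro a b h; exact ⟨a, rfl, h⟩
  | cons e p ih =>
    intro a b h
    obtain ⟨c, h₁, h₂⟩ := ih h.2
    exact ⟨c, ⟨h.1, h₁⟩, h₂⟩

theorem nodup_of_isPath (hΓ : Γ.IsAcyclic) {p : List E} :
    ∀ {a b : NetVertex m n V}, Γ.IsPath a p b → p.Nodup := by
  induction p with
  | nil => intro a b _; exact List.nodup_nil
  | cons e p ih =>
    intro a b h
    refine List.nodup_cons.2 ⟨fun he => ?_, ih h.2⟩
    obtain ⟨q, r, rfl⟩ := List.append_of_mem he
    obtain ⟨c, h₁, h₂⟩ := Γ.isPath_append h.2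
    have hc : Γ.tail e = c := h₂.1
    exact absurd (hΓ c (e :: q) ⟨hc, h₁⟩) (List.cons_ne_nil _ _)

/-- The sums defining the boundary measurements are finite. -/
theorem finite_isPath [Finite E] (hΓ : Γ.IsAcyclic) (a b : NetVertex m n V) :
    {p : List E | Γ.IsPath a p b}.Finite := by
  classical
  have := Fintype.ofFinite E
  exact (List.finite_length_le E (Fintype.card E)).subset
    fun p hp => (Γ.nodup_of_isPath hΓ hp).length_le_card

/-! ### Matrices over `𝒞` and over `𝒞 ⊗ 𝒞` -/

section MatrixOps

variable {k : Type*} [Field k] [Fintype V] {I J I' J' : Type*}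

/-- `⟦X, Y⟧ = ∑ ⟦x i j, y k l⟧ E i j ⊠ E k l`. -/
def matrixBracket [Fintype E] (w : Weights k) (X : Matrix I J (Γ.PathAlg k))
    (Y : Matrix I' J' (Γ.PathAlg k)) :
    Matrix (I × I') (J × J') (Γ.PathAlg k ⊗[k] Γ.PathAlg k) :=
  fun p q => Γ.doubleBracket w (X p.1 q.1) (Y p.2 q.2)

/-- `M_L`, with entries `m i j ⊗ 1`. -/
def leftMat (M : Matrix I J (Γ.PathAlg k)) : Matrix I J (Γ.PathAlg k ⊗[k] Γ.PathAlg k) :=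
  M.map fun x => x ⊗ₜ 1

/-- `M_R`, with entries `1 ⊗ m i j`. -/
def rightMat (M : Matrix I J (Γ.PathAlg k)) : Matrix I J (Γ.PathAlg k ⊗[k] Γ.PathAlg k) :=
  M.map fun x => 1 ⊗ₜ x

/-- A scalar matrix as a matrix over `𝒞 ⊗ 𝒞`. -/
def scalarMat (M : Matrix I J k) : Matrix I J (Γ.PathAlg k ⊗[k] Γ.PathAlg k) :=
  M.map (algebraMap k _)

/-- The entrywise transposition of tensor factors. -/
def tauMat (M : Matrix I J (Γ.PathAlg k ⊗[k] Γ.PathAlg k)) :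
    Matrix I J (Γ.PathAlg k ⊗[k] Γ.PathAlg k) :=
  M.map (Γ.tau k)

/-- The twisted commutator `[A, B]_τ = A B - (B A)^τ`. -/
def twistedCommutator [Fintype I] (A B : Matrix I I (Γ.PathAlg k ⊗[k] Γ.PathAlg k)) :
    Matrix I I (Γ.PathAlg k ⊗[k] Γ.PathAlg k) :=
  A * B - Γ.tauMat (B * A)

end MatrixOps

end CylNetwork

open scoped Kronecker in
/-- The trigonometric `r`-matrix for `GL(n)`. -/
def trigRMatrix {k : Type*} [Field k] (n : ℕ) (lam mu : k) :
    Matrix (Fin n × Fin n) (Fin n × Fin n) k :=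
  ((1 / 2) * ((mu + lam) / (mu - lam))) •
      ∑ a : Fin n, Matrix.single a a (1 : k) ⊗ₖ Matrix.single a a (1 : k) +
    (1 / (mu - lam)) •
      ∑ i : Fin n, ∑ j : Fin n, if i < j then
        lam • Matrix.single i j (1 : k) ⊗ₖ Matrix.single j i (1 : k) +
        mu • Matrix.single j i (1 : k) ⊗ₖ Matrix.single i j (1 : k)
      else 0

/-- The ground field `ℂ(λ, μ)`. -/
abbrev SpectralField : Type := FractionRing (MvPolynomial (Fin 2) ℂ)

/-- The spectral parameter `λ`. -/
def specLam : SpectralField := algebraMap (MvPolynomial (Fin 2) ℂ) SpectralField (MvPolynomial.X 0)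

/-- The spectral parameter `μ`. -/
def specMu : SpectralField := algebraMap (MvPolynomial (Fin 2) ℂ) SpectralField (MvPolynomial.X 1)

end

/-! Collapse each boundary circle of the cylinder to a point. For paths `p` and `q` from sources to
sinks, `p - q` becomes a cycle on the resulting sphere. By Euler's formula the edge functions
orthogonal to all vertex gradients are the face gradients, so `p - q` has a face potential `u`. A
vertex `v` contributes to the bracket the paths that arise from two paths by exchanging their final
parts at `v`. If `p` and `q` are the results, the coefficient is zero unless they meet or part at
`v`; then it has a sign telling which of them is on the left, and is proportional to the power of
`μ / λ` whose exponent is the drop of `u` from the top source face to `v`.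

Let each edge of `p` carry a function of the drop of `u` to the mean of its values on the two sides
of the edge, chosen so that its increments over half a unit are half of that power. Then the
contribution of `v` is the net flow into `v` along `p`. The sum over the vertices telescopes to the
value at the source edge of `p`, a coefficient of `r_m`, minus that at its sink edge, a coefficient
of `r_n`. The cut enters because `u` drops by the difference of the indices of `p` and `q` along
it. -/

namespace CylNetwork

/-! ### Face potentials -/

/-- The functions that are constant on the classes of an equivalence relation. -/
def classFunctions {X : Type*} (s : Setoid X) : Submodule ℚ (X → ℚ) :=
  LinearMap.range (LinearMap.funLeft ℚ ℚ (Quotient.mk s))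

theorem mem_classFunctions {X : Type*} {s : Setoid X} {x : X → ℚ} :
    x ∈ classFunctions s ↔ ∀ a b, s a b → x a = x b :=
  ⟨by rintro ⟨y, rfl⟩ a b h; exact congrArg y (Quotient.sound h), fun h => ⟨Quotient.lift x h, rfl⟩⟩

theorem finrank_classFunctions {X : Type*} [Finite X] (s : Setoid X) :
    Module.finrank ℚ (classFunctions s) = Nat.card (Quotient s) := by
  have := Fintype.ofFinite (Quotient s)
  rw [classFunctions, LinearMap.finrank_range_of_inj
    (LinearMap.funLeft_injective_of_surjective ℚ ℚ _ Quotient.mk_surjective),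
    Module.finrank_fintype_fun_eq_card, Nat.card_eq_fintype_card]

theorem mem_classFunctions_orbitRel_closure {X : Type*} {S : Set (Equiv.Perm X)} {x : X → ℚ} :
    x ∈ classFunctions (MulAction.orbitRel (Subgroup.closure S) X) ↔
      ∀ g ∈ S, ∀ a, x (g a) = x a := by
  rw [mem_classFunctions]
  refine ⟨fun h g hg a => h _ _ ⟨⟨g, Subgroup.subset_closure hg⟩, rfl⟩, ?_⟩
  rintro h _ b ⟨⟨g, hg⟩, rfl⟩
  change x (g b) = x b
  induction hg using Subgroup.closure_induction generalizing b with
  | mem g hg => exact h g hg b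
  | one => rfl
  | mul g₁ g₂ _ _ h₁ h₂ => rw [Equiv.Perm.mul_apply, h₁, h₂]
  | inv g _ hg => rw [← hg, ← Equiv.Perm.mul_apply, mul_inv_cancel, Equiv.Perm.one_apply]

/-- The functions invariant under a permutation. -/
abbrev cycleFunctions {X : Type*} (σ : Equiv.Perm X) : Submodule ℚ (X → ℚ) :=
  classFunctions (Equiv.Perm.SameCycle.setoid σ)

theorem mem_cycleFunctions {X : Type*} {σ : Equiv.Perm X} {x : X → ℚ} :
    x ∈ cycleFunctions σ ↔ ∀ a, x (σ a) = x a := by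
  have : Equiv.Perm.SameCycle.setoid σ =
      MulAction.orbitRel (Subgroup.closure {σ}) X := by
    ext a b
    rw [← Subgroup.zpowers_eq_closure]
    exact Equiv.Perm.sameCycle_comm.trans
      ⟨fun ⟨i, hi⟩ => ⟨⟨σ ^ i, i, rfl⟩, hi⟩, fun ⟨⟨_, i, rfl⟩, hi⟩ => ⟨i, hi⟩⟩
  rw [cycleFunctions, this, mem_classFunctions_orbitRel_closure]
  simp only [Set.mem_singleton_iff, forall_eq]

section Gradient

variable {E : Type*}

theorem rev_rev (d : E × Bool) : rev (rev d) = d :=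
  Prod.ext rfl (Bool.not_not d.2)

/-- The discrete gradient of a function on half-edges along the edges. A function on the vertices
(or on the faces) is encoded as a function on half-edges invariant under rotation (or under
`faceRot`). -/
def gradient : (E × Bool → ℚ) →ₗ[ℚ] E → ℚ :=
  LinearMap.funLeft ℚ ℚ (·, true) - LinearMap.funLeft ℚ ℚ (·, false)

theorem gradient_apply (x : E × Bool → ℚ) (e : E) : gradient x e = x (e, true) - x (e, false) :=
  rfl

theorem gradient_eq_zero {x : E × Bool → ℚ} : gradient x = 0 ↔ ∀ d, x (rev d) = x d := by
  rw [funext_iff, Prod.forall]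
  refine forall_congr' fun e => ?_
  rw [gradient_apply, Bool.forall_bool]
  change _ - _ = (0 : ℚ) ↔ x (e, true) = x (e, false) ∧ x (e, false) = x (e, true)
  rw [sub_eq_zero, eq_comm (a := x (e, false)), and_self]

theorem numCycles_le_finrank_map_gradient [Finite E] (σ : Equiv.Perm (E × Bool)) :
    numCycles σ ≤ Module.finrank ℚ ((cycleFunctions σ).map gradient) +
      Nat.card (MulAction.orbitRel.Quotient (Subgroup.closure {σ, rev}) (E × Bool)) := by
  have hker : (LinearMap.ker (gradient.domRestrict (cycleFunctions σ))).map
      (cycleFunctions σ).subtype ≤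
        classFunctions (MulAction.orbitRel (Subgroup.closure {σ, rev}) (E × Bool)) := by
    rintro _ ⟨⟨x, hx⟩, hx0, rfl⟩
    rw [mem_classFunctions_orbitRel_closure]
    rintro _ (rfl | rfl)
    · exact mem_cycleFunctions.1 hx
    · exact gradient_eq_zero.1 hx0
  have hle := Submodule.finrank_mono hker
  rw [finrank_classFunctions, Submodule.finrank_map_subtype_eq] at hle
  rw [numCycles, ← finrank_classFunctions,
    ← LinearMap.finrank_range_add_finrank_ker (gradient.domRestrict (cycleFunctions σ)),
    LinearMap.range_domRestrict]
  exact Nat.add_le_add_left hle _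

end Gradient

section Hodge

variable {m n : ℕ} {V E : Type*} (Γ : CylNetwork m n V E)

theorem closure_faceRot_rev :
    Subgroup.closure {Γ.faceRot, rev} = Subgroup.closure {Γ.rot, rev} := by
  have hrev (σ : Equiv.Perm (E × Bool)) : rev ∈ Subgroup.closure {σ, rev} :=
    Subgroup.subset_closure (Set.mem_insert_of_mem _ rfl)
  have hself (σ : Equiv.Perm (E × Bool)) : σ ∈ Subgroup.closure {σ, rev} :=
    Subgroup.subset_closure (Set.mem_insert _ _)
  have hrot : Γ.rot = rev * Γ.faceRot⁻¹ := by simp [faceRot]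
  refine le_antisymm ((Subgroup.closure_le _).2 ?_) ((Subgroup.closure_le _).2 ?_)
  · rintro _ (rfl | rfl)
    exacts [mul_mem (inv_mem (hself _)) (hrev _), hrev _]
  · rintro _ (rfl | rfl)
    · rw [hrot]
      exact mul_mem (hrev _) (inv_mem (hself _))
    · exact hrev _

variable {Γ}

theorem apply_rev_rot {u : E × Bool → ℚ} (hu : ∀ d, u (Γ.faceRot d) = u d) (d : E × Bool) :
    u (rev (Γ.rot d)) = u d := by
  rw [← hu (rev (Γ.rot d))]
  congr 1
  simp [faceRot, rev_rev]

theorem gradient_dotProduct_gradient [Fintype E] {x u : E × Bool → ℚ}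
    (hx : ∀ d, x (Γ.rot d) = x d) (hu : ∀ d, u (Γ.faceRot d) = u d) :
    gradient x ⬝ᵥ gradient u = 0 := by
  have h : ∑ d, x d * u d = ∑ d, x d * u (rev d) := by
    rw [← Equiv.sum_comp Γ.rot (fun d => x d * u (rev d))]
    exact Finset.sum_congr rfl fun d _ => by rw [apply_rev_rot hu, hx]
  rw [Fintype.sum_prod_type, Fintype.sum_prod_type, ← sub_eq_zero, ← Finset.sum_sub_distrib] at h
  rw [← h]
  refine Finset.sum_congr rfl fun e _ => ?_
  simp only [gradient_apply, Fintype.sum_bool, rev, Equiv.prodCongr_apply, Prod.map,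
    Equiv.refl_apply, Equiv.boolNot_apply, Bool.not_true, Bool.not_false]
  ring

/-- Orthogonality of the two spaces of gradients is a summation by parts; Euler's formula says that
together they have dimension at least `#E`. -/
theorem exists_facePotential [Fintype E]
    (planar : numCycles Γ.rot + numCycles Γ.faceRot = Fintype.card E + 2 * Γ.numComponents)
    {φ : E → ℚ} (hφ : ∀ x : E × Bool → ℚ, (∀ d, x (Γ.rot d) = x d) → gradient x ⬝ᵥ φ = 0) :
    ∃ u : E × Bool → ℚ, (∀ d, u (Γ.faceRot d) = u d) ∧ gradient u = φ := by
  let B : LinearMap.BilinForm ℚ (E → ℚ) := dotProductBilin ℚ ℚ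
  have hB : B.Nondegenerate :=
    ⟨fun x hx => dotProduct_eq_zero x hx, fun x hx => dotProduct_eq_zero x fun y => by
      rw [dotProduct_comm]; exact hx y⟩
  have hle : (cycleFunctions Γ.faceRot).map gradient ≤
      B.orthogonal ((cycleFunctions Γ.rot).map gradient) := by
    rintro _ ⟨u, hu, rfl⟩ _ ⟨x, hx, rfl⟩
    exact gradient_dotProduct_gradient (mem_cycleFunctions.1 hx) (mem_cycleFunctions.1 hu)
  have heq := Submodule.eq_of_le_of_finrank_le hle (by
    have hV := numCycles_le_finrank_map_gradient Γ.rot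
    have hF := numCycles_le_finrank_map_gradient Γ.faceRot
    rw [closure_faceRot_rev] at hF
    rw [LinearMap.BilinForm.finrank_orthogonal hB, Module.finrank_fintype_fun_eq_card]
    change _ ≤ _ + Γ.numComponents at hV hF
    omega)
  obtain ⟨u, hu, rfl⟩ : φ ∈ (cycleFunctions Γ.faceRot).map gradient := by
    rw [heq]
    rintro _ ⟨x, hx, rfl⟩
    exact hφ x (mem_cycleFunctions.1 hx)
  exact ⟨u, mem_cycleFunctions.1 hu, rfl⟩

end Hodge

/-! ### Paths -/

section Paths

variable {m n : ℕ} {V E : Type*} {Γ : CylNetwork m n V E} {a b c : NetVertex m n V}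
  {p q : List E} {e : E}

theorem IsPath.append (hp : Γ.IsPath a p b) (hq : Γ.IsPath b q c) : Γ.IsPath a (p ++ q) c := by
  induction p generalizing a with
  | nil => exact (show a = b from hp) ▸ hq
  | cons e p ih => exact ⟨hp.1, ih hp.2⟩

theorem isPath_append_cons :
    Γ.IsPath a (p ++ e :: q) b ↔ Γ.IsPath a p (Γ.tail e) ∧ Γ.IsPath (Γ.head e) q b := by
  refine ⟨fun h => ?_, fun h => h.1.append ⟨rfl, h.2⟩⟩
  obtain ⟨c, h₁, rfl, h₂⟩ := Γ.isPath_append h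
  exact ⟨h₁, h₂⟩

theorem index_append (p q : List E) : Γ.index (p ++ q) = Γ.index p + Γ.index q := by
  simp [index]

variable (Γ) in
/-- There is a directed path from `a` to `b`. -/
def Reaches (a b : NetVertex m n V) : Prop := ∃ p, Γ.IsPath a p b

theorem Reaches.refl (a : NetVertex m n V) : Γ.Reaches a a := ⟨[], rfl⟩

theorem Reaches.trans : Γ.Reaches a b → Γ.Reaches b c → Γ.Reaches a c :=
  fun ⟨p, hp⟩ ⟨q, hq⟩ => ⟨p ++ q, hp.append hq⟩

theorem reaches_edge (Γ : CylNetwork m n V E) (e : E) : Γ.Reaches (Γ.tail e) (Γ.head e) :=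
  ⟨[e], rfl, rfl⟩

theorem IsAcyclic.not_reaches_head_tail (hA : Γ.IsAcyclic) (e : E) :
    ¬ Γ.Reaches (Γ.head e) (Γ.tail e) := fun ⟨p, hp⟩ =>
  List.cons_ne_nil e p (hA (Γ.tail e) (e :: p) ⟨rfl, hp⟩)

theorem Reaches.base {d : E × Bool} (h : Γ.Reaches a (Γ.tail d.1)) : Γ.Reaches a (Γ.base d) := by
  obtain ⟨e, _ | _⟩ := d
  exacts [h.trans (Γ.reaches_edge e), h]

theorem Reaches.of_base {d : E × Bool} (h : Γ.Reaches (Γ.head d.1) b) :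
    Γ.Reaches (Γ.base d) b := by
  obtain ⟨e, _ | _⟩ := d
  exacts [h, (Γ.reaches_edge e).trans h]

theorem IsPath.reaches_tail (hp : Γ.IsPath a p b) (he : e ∈ p) : Γ.Reaches a (Γ.tail e) := by
  obtain ⟨q, r, rfl⟩ := List.append_of_mem he
  exact ⟨q, (isPath_append_cons.1 hp).1⟩

theorem IsPath.head_reaches (hp : Γ.IsPath a p b) (he : e ∈ p) : Γ.Reaches (Γ.head e) b := by
  obtain ⟨q, r, rfl⟩ := List.append_of_mem he
  exact ⟨r, (isPath_append_cons.1 hp).2⟩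

theorem IsPath.exists_mem_tail_eq (hp : Γ.IsPath a p b) (hab : a ≠ b) :
    ∃ e ∈ p, Γ.tail e = a := by
  cases p with
  | nil => exact absurd hp hab
  | cons e p => exact ⟨e, List.mem_cons_self, hp.1⟩

theorem IsPath.exists_mem_head_eq (hp : Γ.IsPath a p b) (hab : a ≠ b) :
    ∃ e ∈ p, Γ.head e = b := by
  rcases List.eq_nil_or_concat p with rfl | ⟨q, e, rfl⟩
  · exact absurd hp hab
  · rw [List.concat_eq_append] at hp ⊢
    exact ⟨e, List.mem_append_right q List.mem_cons_self, (isPath_append_cons.1 hp).2⟩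

theorem IsPerfect.not_head_reaches_source (hP : Γ.IsPerfect) {i : Fin m} (e : E) :
    ¬ Γ.Reaches (Γ.head e) (.source i) := by
  rintro ⟨p, hp⟩
  obtain ⟨f, -, hf⟩ := hp.exists_mem_head_eq (hP.source_out i e)
  exact hP.source_out i f hf

theorem IsPerfect.not_sink_reaches_tail (hP : Γ.IsPerfect) {j : Fin n} (e : E) :
    ¬ Γ.Reaches (.sink j) (Γ.tail e) := by
  rintro ⟨p, hp⟩
  obtain ⟨f, -, hf⟩ := hp.exists_mem_tail_eq (hP.sink_in j e).symm
  exact hP.sink_in j f hf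

end Paths

/-! ### Rotation around the vertices -/

theorem eq_of_sameCycle {X α : Type*} [Finite X] {σ : Equiv.Perm X} {f : X → α} (S : Set X)
    (hS : ∀ x ∈ S, σ x ∈ S) (hf : ∀ x ∈ S, f (σ x) = f x) {x y : X} (h : σ.SameCycle x y)
    (hx : x ∈ S) : f y = f x := by
  obtain ⟨N, -, -, rfl⟩ := h.exists_pow_eq'
  have key (N : ℕ) : (σ ^ N) x ∈ S ∧ f ((σ ^ N) x) = f x := by
    induction N with
    | zero => exact ⟨hx, rfl⟩
    | succ N ih =>
      rw [pow_succ', Equiv.Perm.mul_apply]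
      exact ⟨hS _ ih.1, (hf _ ih.1).trans ih.2⟩
  exact (key N).2

theorem eq_of_comp_finRotate {α : Type*} {N : ℕ} {F : Fin N → α}
    (hF : ∀ i, F (finRotate N i) = F i) (i j : Fin N) : F i = F j := by
  cases N with
  | zero => exact i.elim0
  | succ N =>
    have key (i : Fin (N + 1)) : F i = F 0 := by
      induction i using Fin.induction with
      | zero => rfl
      | succ i ih => rw [← ih, ← hF i.castSucc, finRotate_apply, Fin.coeSucc_eq_succ]
    rw [key i, key j]

section Rotation

variable {m n : ℕ} {V E : Type*} {Γ : CylNetwork m n V E}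

namespace IsPerfect

variable (hP : Γ.IsPerfect)
include hP

theorem exists_forall_base_source (i : Fin m) : ∃ e, ∀ d, Γ.base d = .source i ↔ d = (e, true) := by
  obtain ⟨⟨e, b⟩, hd, hu⟩ := hP.source_univalent i
  cases b with
  | true => exact ⟨e, fun d => ⟨hu d, fun h => h ▸ hd⟩⟩
  | false => exact absurd hd (hP.source_out i e)

theorem exists_forall_base_sink (j : Fin n) : ∃ e, ∀ d, Γ.base d = .sink j ↔ d = (e, false) := by
  obtain ⟨⟨e, b⟩, hd, hu⟩ := hP.sink_univalent j
  cases b with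
  | false => exact ⟨e, fun d => ⟨hu d, fun h => h ▸ hd⟩⟩
  | true => exact absurd hd (hP.sink_in j e)

/-- The unique edge at a source. -/
noncomputable def sourceEdge (i : Fin m) : E := (hP.exists_forall_base_source i).choose

/-- The unique edge at a sink. -/
noncomputable def sinkEdge (j : Fin n) : E := (hP.exists_forall_base_sink j).choose

theorem base_eq_source {i : Fin m} {d : E × Bool} :
    Γ.base d = .source i ↔ d = (hP.sourceEdge i, true) :=
  (hP.exists_forall_base_source i).choose_spec d

theorem base_eq_sink {j : Fin n} {d : E × Bool} :
    Γ.base d = .sink j ↔ d = (hP.sinkEdge j, false) :=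
  (hP.exists_forall_base_sink j).choose_spec d

theorem tail_eq_source {i : Fin m} {e : E} : Γ.tail e = .source i ↔ e = hP.sourceEdge i :=
  (hP.base_eq_source (d := (e, true))).trans (by rw [Prod.mk.injEq, and_iff_left rfl])

theorem head_eq_sink {j : Fin n} {e : E} : Γ.head e = .sink j ↔ e = hP.sinkEdge j :=
  (hP.base_eq_sink (d := (e, false))).trans (by rw [Prod.mk.injEq, and_iff_left rfl])

theorem tail_sourceEdge (i : Fin m) : Γ.tail (hP.sourceEdge i) = .source i :=
  hP.tail_eq_source.2 rfl

theorem head_sinkEdge (j : Fin n) : Γ.head (hP.sinkEdge j) = .sink j :=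
  hP.head_eq_sink.2 rfl

variable [Fintype E] (hE : Γ.IsEmbedded)
include hE

theorem rot_sourceEdge (i : Fin m) :
    Γ.rot (hP.sourceEdge (finRotate m i), true) = (hP.sourceEdge i, true) := by
  have h := hE.rot_source _ _ (hP.base_eq_source.2 (Eq.refl (hP.sourceEdge (finRotate m i), true)))
  rwa [Equiv.symm_apply_apply, hP.base_eq_source] at h

theorem rot_sinkEdge (j : Fin n) :
    Γ.rot (hP.sinkEdge j, false) = (hP.sinkEdge (finRotate n j), false) :=
  hP.base_eq_sink.1 (hE.rot_sink _ j (hP.base_eq_sink.2 rfl))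

theorem eq_of_base_eq {α : Type*} {f : E × Bool → α} {a : NetVertex m n V}
    (hf : ∀ d, Γ.base (Γ.rot d) = a → f (Γ.rot d) = f d) {d d' : E × Bool} (hd : Γ.base d = a)
    (hd' : Γ.base d' = a) : f d = f d' := by
  cases a with
  | source i => rw [hP.base_eq_source.1 hd, hP.base_eq_source.1 hd']
  | sink j => rw [hP.base_eq_sink.1 hd, hP.base_eq_sink.1 hd']
  | inner v =>
    exact eq_of_sameCycle {d | Γ.base d = .inner v} (fun d h => hE.rot_inner d v h)
      (fun d h => hf d (hE.rot_inner d v h)) (hE.rot_inner_cyclic d' d v hd' hd) hd'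

/-- The vertices of the sphere are those of the network, with all the sources identified and all
the sinks identified. -/
theorem exists_vertexFunction {x : E × Bool → ℚ} (hx : ∀ d, x (Γ.rot d) = x d) :
    ∃ X : NetVertex m n V → ℚ, (∀ d, x d = X (Γ.base d)) ∧
      (∀ i i', X (.source i) = X (.source i')) ∧ ∀ j j', X (.sink j) = X (.sink j') := by
  choose e he using hP.inner_not_source
  let X : NetVertex m n V → ℚ
    | .source i => x (hP.sourceEdge i, true)
    | .inner v => x (e v, false)
    | .sink j => x (hP.sinkEdge j, false)
  refine ⟨X, fun d => ?_, eq_of_comp_finRotate fun i => ?_, eq_of_comp_finRotate fun j => ?_⟩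
  · cases hd : Γ.base d with
    | source i => rw [hP.base_eq_source.1 hd]
    | inner v => exact hP.eq_of_base_eq hE (fun d _ => hx d) hd (he v)
    | sink j => rw [hP.base_eq_sink.1 hd]
  · exact (hx _).symm.trans (congrArg x (hP.rot_sourceEdge hE i))
  · exact (congrArg x (hP.rot_sinkEdge hE j)).symm.trans (hx _)

end IsPerfect

end Rotation

/-! ### Potentials of differences of paths -/

theorem sum_count_mul {X : Type*} [Fintype X] [DecidableEq X] (l : List X) (y : X → ℚ) :
    ∑ x, (l.count x : ℚ) * y x = (l.map y).sum := by
  rw [Finset.sum_list_map_count]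
  simp only [nsmul_eq_mul]
  refine (Finset.sum_subset (Finset.subset_univ _) fun x _ hx => ?_).symm
  rw [List.count_eq_zero_of_not_mem (mt List.mem_toFinset.2 hx), Nat.cast_zero, zero_mul]

section PathDiff

variable {E : Type*}

open Classical in
/-- The difference of two paths, as a `1`-chain. -/
noncomputable def pathDiff (p q : List E) (e : E) : ℚ := p.count e - q.count e

theorem dotProduct_pathDiff [Fintype E] (y : E → ℚ) (p q : List E) :
    y ⬝ᵥ pathDiff p q = (p.map y).sum - (q.map y).sum := by
  classical
  rw [dotProduct_comm, ← sum_count_mul, ← sum_count_mul, ← Finset.sum_sub_distrib]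
  exact Finset.sum_congr rfl fun e _ => by rw [pathDiff, ← sub_mul]

theorem mem_or_mem_of_pathDiff_ne_zero {p q : List E} {e : E} (h : pathDiff p q e ≠ 0) :
    e ∈ p ∨ e ∈ q := by
  classical
  by_contra! hc
  rw [pathDiff, List.count_eq_zero_of_not_mem hc.1, List.count_eq_zero_of_not_mem hc.2,
    sub_self] at h
  exact h rfl

theorem pathDiff_append_cons (p₁ p₂ q₁ q₂ : List E) (e : E) :
    pathDiff (p₁ ++ e :: p₂) (q₁ ++ e :: q₂) = pathDiff p₁ q₁ + pathDiff p₂ q₂ := by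
  ext f
  simp only [pathDiff, Pi.add_apply, List.count_append, List.count_cons, Nat.cast_add]
  ring

end PathDiff

section Potential

variable {m n : ℕ} {V E : Type*} {Γ : CylNetwork m n V E}

variable (Γ) in
/-- `u` is a function on the faces which drops by `φ e` when the edge `e` is crossed from left to
right. -/
structure IsPotential (u : E × Bool → ℚ) (φ : E → ℚ) : Prop where
  faceRot (d : E × Bool) : u (Γ.faceRot d) = u d
  gradient_eq : gradient u = φ

theorem IsPath.sum_tail_sub_head {p : List E} {a b : NetVertex m n V} (hp : Γ.IsPath a p b)
    (X : NetVertex m n V → ℚ) : (p.map fun e => X (Γ.tail e) - X (Γ.head e)).sum = X a - X b := by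
  induction p generalizing a with
  | nil => rw [show a = b from hp]; exact (sub_self _).symm
  | cons e p ih => rw [List.map_cons, List.sum_cons, ih hp.2, hp.1, sub_add_sub_cancel]

/-- The hypothesis says that `p - q` is a cycle on the sphere. -/
theorem IsPerfect.exists_isPotential_pathDiff [Fintype E] (hP : Γ.IsPerfect) (hE : Γ.IsEmbedded)
    {p q : List E} {a b a' b' : NetVertex m n V} (hp : Γ.IsPath a p b) (hq : Γ.IsPath a' q b')
    (h : ∀ X : NetVertex m n V → ℚ, (∀ i i', X (.source i) = X (.source i')) →
      (∀ j j', X (.sink j) = X (.sink j')) → X a - X b = X a' - X b') :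
    ∃ u, Γ.IsPotential u (pathDiff p q) := by
  obtain ⟨u, hu, hgrad⟩ := exists_facePotential hE.planar (φ := pathDiff p q) fun x hx => by
    obtain ⟨X, hX, hsource, hsink⟩ := hP.exists_vertexFunction hE hx
    have hgrad : gradient x = fun e => X (Γ.tail e) - X (Γ.head e) :=
      funext fun e => congrArg₂ (· - ·) (hX _) (hX _)
    rw [hgrad, dotProduct_pathDiff, hp.sum_tail_sub_head, hq.sum_tail_sub_head,
      h X hsource hsink, sub_self]
  exact ⟨u, hu, hgrad⟩

theorem index_singleton [DecidableEq (E × Bool)] (Γ : CylNetwork m n V E) (e : E) :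
    Γ.index [e] = Γ.cut.count (e, true) - Γ.cut.count (e, false) := by
  rw [index, List.map_singleton, List.sum_singleton]
  congr!

namespace IsPotential

variable {u : E × Bool → ℚ} {φ : E → ℚ} (hu : Γ.IsPotential u φ)
include hu

theorem sub_eq (e : E) : u (e, true) - u (e, false) = φ e := congrFun hu.gradient_eq e

theorem rev_rot (d : E × Bool) : u (rev (Γ.rot d)) = u d := apply_rev_rot hu.faceRot d

theorem rev_eq_of_rot_eq {d d' : E × Bool} (h : Γ.rot d = d') : u (rev d') = u d :=
  h ▸ hu.rev_rot d

theorem rev_eq_of_eq_zero {d : E × Bool} (h : φ d.1 = 0) : u (rev d) = u d := by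
  have hd := sub_eq_zero.1 ((hu.sub_eq d.1).trans h)
  obtain ⟨e, _ | _⟩ := d
  exacts [hd, hd.symm]

theorem rot_eq_of_eq_zero {d : E × Bool} (h : φ (Γ.rot d).1 = 0) : u (Γ.rot d) = u d := by
  rw [← hu.rev_rot d, hu.rev_eq_of_eq_zero h]

theorem sub {u' : E × Bool → ℚ} {φ' : E → ℚ} (hu' : Γ.IsPotential u' φ') :
    Γ.IsPotential (u - u') (φ - φ') where
  faceRot d := by rw [Pi.sub_apply, Pi.sub_apply, hu.faceRot, hu'.faceRot]
  gradient_eq := by rw [map_sub, hu.gradient_eq, hu'.gradient_eq]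

theorem sub_eq_sum_of_isDualWalk {l : List (E × Bool)} {d d' : E × Bool}
    (h : Γ.IsDualWalk d l d') : u d - u d' = (l.map fun x => u x - u (rev x)).sum := by
  have hface {d d' : E × Bool} : Γ.faceRot.SameCycle d d' → u d = u d' :=
    mem_classFunctions.1 (mem_cycleFunctions.2 hu.faceRot) d d'
  induction l generalizing d with
  | nil => exact sub_eq_zero.2 (hface h)
  | cons x l ih =>
    rw [List.map_cons, List.sum_cons, ← ih h.2, hface h.1]
    exact (sub_add_sub_cancel _ _ _).symm

theorem sum_sub_rev_cut [Fintype E] : (Γ.cut.map fun x => u x - u (rev x)).sum =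
    (fun e => (Γ.index [e] : ℚ)) ⬝ᵥ φ := by
  classical
  rw [← sum_count_mul, Fintype.sum_prod_type]
  refine Finset.sum_congr rfl fun e _ => ?_
  rw [Fintype.sum_bool, ← hu.sub_eq e]
  change _ * (u (e, true) - u (e, false)) + _ * (u (e, false) - u (e, true)) =
    (Γ.index [e] : ℚ) * _
  rw [index_singleton]
  push_cast
  ring

section Supported

variable [Fintype E] (hP : Γ.IsPerfect) (hE : Γ.IsEmbedded)
include hE

theorem sourceEdge_eq (h : ∀ i, φ (hP.sourceEdge i) = 0) (i i' : Fin m) :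
    u (hP.sourceEdge i, true) = u (hP.sourceEdge i', true) := by
  refine eq_of_comp_finRotate (F := fun i => u (hP.sourceEdge i, true)) (fun i => ?_) i i'
  have hrot := hP.rot_sourceEdge hE i
  rw [← hrot]
  exact (hu.rot_eq_of_eq_zero (by rw [hrot]; exact h i)).symm

theorem sinkEdge_eq (h : ∀ j, φ (hP.sinkEdge j) = 0) (j j' : Fin n) :
    u (hP.sinkEdge j, false) = u (hP.sinkEdge j', false) := by
  refine eq_of_comp_finRotate (F := fun j => u (hP.sinkEdge j, false)) (fun j => ?_) j j'
  have hrot := hP.rot_sinkEdge hE j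
  rw [← hrot]
  exact hu.rot_eq_of_eq_zero (by rw [hrot]; exact h _)

include hP

theorem eq_of_reaches {a b : NetVertex m n V} (hab : Γ.Reaches a b)
    (h : ∀ c, Γ.Reaches a c → Γ.Reaches c b → ∀ d, Γ.base d = c → φ d.1 = 0) {d d' : E × Bool}
    (hd : Γ.base d = a) (hd' : Γ.base d' = b) : u d = u d' := by
  have hvertex {c : NetVertex m n V} (hc : ∀ d, Γ.base d = c → φ d.1 = 0) {d d' : E × Bool} :
      Γ.base d = c → Γ.base d' = c → u d = u d' :=
    hP.eq_of_base_eq hE fun d hd => hu.rot_eq_of_eq_zero (hc _ hd)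
  obtain ⟨p, hp⟩ := hab
  induction p generalizing a d with
  | nil =>
    obtain rfl : a = b := hp
    exact hvertex (h a (.refl a) (.refl a)) hd hd'
  | cons e p ih =>
    obtain ⟨rfl, hp⟩ := hp
    have htail := h (Γ.tail e) (.refl _) ((Γ.reaches_edge e).trans ⟨p, hp⟩)
    calc u d = u (e, true) := hvertex htail hd rfl
      _ = u (e, false) := (hu.rev_eq_of_eq_zero (htail (e, true) rfl)).symm
      _ = u d' := ih (fun c hc => h c ((Γ.reaches_edge e).trans hc)) rfl hp

variable (hA : Γ.IsAcyclic) {e : E}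
include hA

theorem sourceEdge_eq_of_downstream (hφ : ∀ f, φ f ≠ 0 → Γ.Reaches (Γ.head e) (Γ.tail f))
    {k : Fin m} (hk : Γ.Reaches (.source k) (Γ.tail e)) (i : Fin m) :
    u (hP.sourceEdge i, true) = u (e, true) := by
  rw [hu.sourceEdge_eq hP hE (fun i => ?_) i k]
  · refine hu.eq_of_reaches hP hE hk (fun c _ hc d hd => ?_) (hP.tail_sourceEdge k) rfl
    by_contra hne
    exact hA.not_reaches_head_tail e ((hφ _ hne).base.trans (hd ▸ hc))
  · by_contra hne
    exact hP.not_head_reaches_source e (hP.tail_sourceEdge i ▸ hφ _ hne)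

theorem sinkEdge_eq_of_upstream (hφ : ∀ f, φ f ≠ 0 → Γ.Reaches (Γ.head f) (Γ.tail e))
    {l : Fin n} (hl : Γ.Reaches (Γ.head e) (.sink l)) (j : Fin n) :
    u (hP.sinkEdge j, true) = u (e, true) := by
  have hzero {f : E} (hf : ¬ Γ.Reaches (Γ.head f) (Γ.tail e)) : φ f = 0 := not_not.1 (mt (hφ f) hf)
  have hsink (j : Fin n) : φ (hP.sinkEdge j) = 0 :=
    hzero fun h => hP.not_sink_reaches_tail e (hP.head_sinkEdge j ▸ h)
  calc u (hP.sinkEdge j, true)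
      = u (hP.sinkEdge j, false) := (hu.rev_eq_of_eq_zero (d := (_, true)) (hsink j)).symm
    _ = u (hP.sinkEdge l, false) := hu.sinkEdge_eq hP hE hsink j l
    _ = u (e, false) := Eq.symm <| hu.eq_of_reaches hP hE hl
      (fun c hc _ d hd => hzero fun h => hA.not_reaches_head_tail e
        (hc.trans (hd ▸ h.of_base))) rfl (hP.head_sinkEdge l)
    _ = u (e, true) :=
      hu.rev_eq_of_eq_zero (d := (e, true)) (hzero (hA.not_reaches_head_tail e))

end Supported

end IsPotential

section Index

variable [NeZero m] [NeZero n] {u : E × Bool → ℚ} {p q : List E}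

theorem IsPotential.source_sub_sink_eq_index [Finite E] (hP : Γ.IsPerfect) (hC : Γ.IsCut)
    (hu : Γ.IsPotential u (pathDiff p q)) :
    u (hP.sourceEdge 0, true) - u (hP.sinkEdge 0, true) = Γ.index p - Γ.index q := by
  have := Fintype.ofFinite E
  have hwalk := hC 0 0 (hP.sourceEdge 0) (hP.sinkEdge 0) rfl rfl (hP.tail_sourceEdge 0)
    (hP.head_sinkEdge 0)
  rw [hu.sub_eq_sum_of_isDualWalk hwalk, hu.sum_sub_rev_cut, dotProduct_pathDiff]
  simp only [index, List.map_cons, List.map_nil, List.sum_singleton, Int.cast_list_sum,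
    List.map_map, Function.comp_def]

/-- Split the potential into that of the initial segments, which is constant downstream of `e`, and
that of the final segments, which is constant upstream of `e`. -/
theorem IsPotential.source_sub_eq_index [Fintype E] (hΓ : Γ.IsPerfectCylindrical)
    {p₁ p₂ q₁ q₂ : List E} {e : E} {k i : Fin m} {j l : Fin n}
    (hp : Γ.IsPath (.source k) (p₁ ++ e :: p₂) (.sink j))
    (hq : Γ.IsPath (.source i) (q₁ ++ e :: q₂) (.sink l))
    (hu : Γ.IsPotential u (pathDiff (p₁ ++ e :: p₂) (q₁ ++ e :: q₂))) :
    u (hΓ.perfect.sourceEdge 0, true) - u (e, true) = Γ.index p₁ - Γ.index q₁ := by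
  obtain ⟨hP, hE, hC, hA⟩ := hΓ
  obtain ⟨hp₁, hp₂⟩ := isPath_append_cons.1 hp
  obtain ⟨hq₁, hq₂⟩ := isPath_append_cons.1 hq
  obtain ⟨u₁, hu₁⟩ := hP.exists_isPotential_pathDiff hE hp₁ hq₁ fun X hsource _ => by
    rw [hsource k i]
  have hu₂ : Γ.IsPotential (u - u₁) (pathDiff p₂ q₂) := by
    simpa only [pathDiff_append_cons, add_sub_cancel_left] using hu.sub hu₁
  have hinitial : u₁ (hP.sinkEdge 0, true) = u₁ (e, true) :=
    hu₁.sinkEdge_eq_of_upstream hP hE hA (fun f hf => (mem_or_mem_of_pathDiff_ne_zero hf).elim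
      hp₁.head_reaches hq₁.head_reaches) ⟨p₂, hp₂⟩ 0
  have hfinal : (u - u₁) (hP.sourceEdge 0, true) = (u - u₁) (e, true) :=
    hu₂.sourceEdge_eq_of_downstream hP hE hA (fun f hf => (mem_or_mem_of_pathDiff_ne_zero hf).elim
      hp₂.reaches_tail hq₂.reaches_tail) ⟨p₁, hp₁⟩ 0
  rw [Pi.sub_apply, Pi.sub_apply] at hfinal
  linear_combination hfinal + hinitial + hu₁.source_sub_sink_eq_index hP hC

end Index

end Potential

/-! ### White and black vertices -/

section Vertices

variable {m n : ℕ} {V E : Type*} {Γ : CylNetwork m n V E} {v : V} {x₁ x₂ x₃ y₁ y₂ y₃ : E}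

section RotCycle

variable [Fintype E] (hP : Γ.IsPerfect) (hE : Γ.IsEmbedded)
include hP hE

theorem IsPerfect.exists_isCycleOn_rot (v : V) : ∃ s : Finset (E × Bool),
    Γ.rot.IsCycleOn s ∧ s.card = 3 ∧ ∀ d, d ∈ s ↔ Γ.base d = .inner v := by
  classical
  let s : Finset (E × Bool) := {d | Γ.base d = .inner v}
  have hs (d) : d ∈ s ↔ Γ.base d = .inner v := Finset.mem_filter_univ d
  have hmaps : Set.MapsTo Γ.rot s s := fun d hd => (hs _).2 (hE.rot_inner d v ((hs d).1 hd))
  refine ⟨s, ⟨⟨hmaps, Γ.rot.injective.injOn, ?_⟩, fun d hd d' hd' => ?_⟩, ?_, hs⟩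
  · exact Finset.surjOn_of_injOn_of_card_le Γ.rot hmaps Γ.rot.injective.injOn le_rfl
  · exact hE.rot_inner_cyclic d d' v ((hs d).1 hd) ((hs d').1 hd')
  · rw [← hP.trivalent v, Nat.card_eq_fintype_card, Fintype.card_subtype]

variable {d : E × Bool} (hd : Γ.base d = .inner v)
include hd

theorem IsPerfect.rot_ne_self : Γ.rot d ≠ d := by
  obtain ⟨s, hcyc, hcard, hs⟩ := hP.exists_isCycleOn_rot hE v
  exact hcyc.apply_ne (Finset.one_lt_card_iff_nontrivial.1 (by lia)) ((hs d).2 hd)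

theorem IsPerfect.rot_rot_rot : Γ.rot (Γ.rot (Γ.rot d)) = d := by
  obtain ⟨s, hcyc, hcard, hs⟩ := hP.exists_isCycleOn_rot hE v
  have h := hcyc.pow_card_apply ((hs d).2 hd)
  rwa [hcard] at h

theorem IsPerfect.base_eq_inner {d' : E × Bool} :
    Γ.base d' = .inner v ↔ d' = d ∨ d' = Γ.rot d ∨ d' = Γ.rot (Γ.rot d) := by
  obtain ⟨s, hcyc, hcard, hs⟩ := hP.exists_isCycleOn_rot hE v
  have hrot := hE.rot_inner d v hd
  constructor
  · intro hd'
    obtain ⟨N, hN, rfl⟩ := hcyc.exists_pow_eq ((hs d).2 hd) ((hs d').2 hd')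
    rw [hcard] at hN
    interval_cases N
    exacts [.inl rfl, .inr (.inl rfl), .inr (.inr rfl)]
  · rintro (rfl | rfl | rfl)
    exacts [hd, hrot, hE.rot_inner _ v hrot]

end RotCycle

section Colors

variable [Fintype E] (hP : Γ.IsPerfect) (hE : Γ.IsEmbedded)
include hP hE

theorem IsWhite.head_eq (h : Γ.IsWhite v x₁ x₂ x₃) {e : E} : Γ.head e = .inner v ↔ e = x₃ := by
  obtain ⟨hx₃, h₁, h₂, -⟩ := h
  exact (hP.base_eq_inner hE (d := (x₃, false)) (d' := (e, false)) hx₃).trans (by simp [h₁, h₂])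

theorem IsWhite.tail_eq (h : Γ.IsWhite v x₁ x₂ x₃) {e : E} :
    Γ.tail e = .inner v ↔ e = x₁ ∨ e = x₂ := by
  obtain ⟨hx₃, h₁, h₂, -⟩ := h
  exact (hP.base_eq_inner hE (d := (x₃, false)) (d' := (e, true)) hx₃).trans (by simp [h₁, h₂])

theorem IsWhite.ne (h : Γ.IsWhite v x₁ x₂ x₃) : x₁ ≠ x₂ := by
  rintro rfl
  exact hP.rot_ne_self hE (d := (x₁, true)) ((h.tail_eq hP hE).2 (.inl rfl)) h.2.2.1

theorem IsBlack.tail_eq (h : Γ.IsBlack v y₁ y₂ y₃) {e : E} : Γ.tail e = .inner v ↔ e = y₃ := by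
  obtain ⟨hy₃, h₁, h₂, -⟩ := h
  exact (hP.base_eq_inner hE (d := (y₃, true)) (d' := (e, true)) hy₃).trans (by simp [h₁, h₂])

theorem IsBlack.head_eq (h : Γ.IsBlack v y₁ y₂ y₃) {e : E} :
    Γ.head e = .inner v ↔ e = y₁ ∨ e = y₂ := by
  obtain ⟨hy₃, h₁, h₂, -⟩ := h
  exact (hP.base_eq_inner hE (d := (y₃, true)) (d' := (e, false)) hy₃).trans (by simp [h₁, h₂])

theorem IsBlack.ne (h : Γ.IsBlack v y₁ y₂ y₃) : y₁ ≠ y₂ := by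
  rintro rfl
  exact hP.rot_ne_self hE (d := (y₁, false)) ((h.head_eq hP hE).2 (.inl rfl)) h.2.2.1

theorem IsWhite.not_isBlack (hx : Γ.IsWhite v x₁ x₂ x₃) : ¬ Γ.IsBlack v y₁ y₂ y₃ := fun hy =>
  hy.ne hP hE <|
    ((hx.head_eq hP hE).1 ((hy.head_eq hP hE).2 (.inl rfl))).trans
      ((hx.head_eq hP hE).1 ((hy.head_eq hP hE).2 (.inr rfl))).symm

theorem IsWhite.isWhite_iff (hx : Γ.IsWhite v x₁ x₂ x₃) :
    Γ.IsWhite v y₁ y₂ y₃ ↔ y₃ = x₃ ∧ y₂ = x₂ ∧ y₁ = x₁ := by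
  refine ⟨fun hy => ?_, by rintro ⟨rfl, rfl, rfl⟩; exact hx⟩
  obtain rfl := (hx.head_eq hP hE).1 hy.1
  obtain rfl : y₁ = x₁ := congrArg Prod.fst (hy.2.1.symm.trans hx.2.1)
  obtain rfl : y₂ = x₂ := congrArg Prod.fst (hy.2.2.1.symm.trans hx.2.2.1)
  exact ⟨rfl, rfl, rfl⟩

theorem IsBlack.isBlack_iff (hx : Γ.IsBlack v x₁ x₂ x₃) :
    Γ.IsBlack v y₁ y₂ y₃ ↔ y₃ = x₃ ∧ y₂ = x₂ ∧ y₁ = x₁ := by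
  refine ⟨fun hy => ?_, by rintro ⟨rfl, rfl, rfl⟩; exact hx⟩
  obtain rfl := (hx.tail_eq hP hE).1 hy.1
  obtain rfl : y₁ = x₁ := congrArg Prod.fst (hy.2.1.symm.trans hx.2.1)
  obtain rfl : y₂ = x₂ := congrArg Prod.fst (hy.2.2.1.symm.trans hx.2.2.1)
  exact ⟨rfl, rfl, rfl⟩

theorem IsPerfect.isWhite_or_isBlack (v : V) :
    (∃ x₁ x₂ x₃, Γ.IsWhite v x₁ x₂ x₃) ∨ ∃ y₁ y₂ y₃, Γ.IsBlack v y₁ y₂ y₃ := by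
  obtain ⟨x, hx⟩ := hP.inner_not_source v
  obtain ⟨y, hy⟩ := hP.inner_not_sink v
  have hd : Γ.base (x, false) = .inner v := hx
  have hy : (y, true) = _ ∨ (y, true) = _ ∨ (y, true) = _ := (hP.base_eq_inner hE hd).1 hy
  have hrot := hE.rot_inner _ v hd
  have hrotrot := hE.rot_inner _ v hrot
  have hcycle := hP.rot_rot_rot hE hd
  obtain ⟨⟨a, _ | _⟩, ha⟩ : ∃ d, Γ.rot (x, false) = d := ⟨_, rfl⟩ <;>
    obtain ⟨⟨b, _ | _⟩, hb⟩ : ∃ d, Γ.rot (Γ.rot (x, false)) = d := ⟨_, rfl⟩ <;>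
    rw [hb] at hcycle hrotrot hy <;> rw [ha] at hb hrot hy
  · simp only [Prod.mk.injEq, Bool.true_eq_false, and_false, or_self] at hy
  · exact .inr ⟨x, a, b, hrotrot, hcycle, ha, hb⟩
  · exact .inr ⟨b, x, a, hrot, hb, hcycle, ha⟩
  · exact .inl ⟨a, b, x, hx, ha, hb, hcycle⟩

open Classical in
theorem IsWhite.sum_eq (h : Γ.IsWhite v x₁ x₂ x₃) {M : Type*} [AddCommMonoid M]
    (F F' : E → E → E → M) :
    ∑ y₁, ∑ y₂, ∑ y₃, ((if Γ.IsWhite v y₁ y₂ y₃ then F y₁ y₂ y₃ else 0) +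
      if Γ.IsBlack v y₁ y₂ y₃ then F' y₁ y₂ y₃ else 0) = F x₁ x₂ x₃ := by
  simp only [h.isWhite_iff hP hE, h.not_isBlack hP hE, if_false, add_zero, ite_and,
    Finset.sum_ite_eq', Finset.mem_univ, if_true]

open Classical in
theorem IsBlack.sum_eq (h : Γ.IsBlack v x₁ x₂ x₃) {M : Type*} [AddCommMonoid M]
    (F F' : E → E → E → M) :
    ∑ y₁, ∑ y₂, ∑ y₃, ((if Γ.IsWhite v y₁ y₂ y₃ then F y₁ y₂ y₃ else 0) +
      if Γ.IsBlack v y₁ y₂ y₃ then F' y₁ y₂ y₃ else 0) = F' x₁ x₂ x₃ := by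
  have hwhite (y₁ y₂ y₃ : E) : ¬ Γ.IsWhite v y₁ y₂ y₃ := fun h' => h'.not_isBlack hP hE h
  simp only [h.isBlack_iff hP hE, hwhite, if_false, zero_add, ite_and, Finset.sum_ite_eq',
    Finset.mem_univ, if_true]

end Colors

/-! ### Paths through a vertex -/

section PathsThrough

variable {p q : List E} {a b : NetVertex m n V} {e f : E}

theorem IsPath.reaches_of_mem_of_mem (hp : Γ.IsPath a p b) (he : e ∈ p) (hf : f ∈ p)
    (hne : e ≠ f) : Γ.Reaches (Γ.head e) (Γ.tail f) ∨ Γ.Reaches (Γ.head f) (Γ.tail e) := by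
  obtain ⟨p₁, p₂, rfl⟩ := List.append_of_mem he
  obtain ⟨hp₁, hp₂⟩ := isPath_append_cons.1 hp
  rcases List.mem_append.1 hf with hf | hf
  · exact .inr (hp₁.head_reaches hf)
  · exact .inl (hp₂.reaches_tail (List.mem_of_ne_of_mem hne.symm hf))

theorem IsPath.eq_of_tail_eq (hA : Γ.IsAcyclic) (hp : Γ.IsPath a p b) (he : e ∈ p) (hf : f ∈ p)
    (h : Γ.tail e = Γ.tail f) : e = f := by
  by_contra hne
  rcases hp.reaches_of_mem_of_mem he hf hne with h' | h'
  · exact hA.not_reaches_head_tail e (h ▸ h')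
  · exact hA.not_reaches_head_tail f (h ▸ h')

theorem IsPath.eq_of_head_eq (hA : Γ.IsAcyclic) (hp : Γ.IsPath a p b) (he : e ∈ p) (hf : f ∈ p)
    (h : Γ.head e = Γ.head f) : e = f := by
  by_contra hne
  rcases hp.reaches_of_mem_of_mem he hf hne with h' | h'
  · exact hA.not_reaches_head_tail f (h ▸ h')
  · exact hA.not_reaches_head_tail e (h ▸ h')

theorem IsPath.exists_mem_head_eq_tail (hp : Γ.IsPath a p b) (he : e ∈ p) (ha : a ≠ Γ.tail e) :
    ∃ f ∈ p, Γ.head f = Γ.tail e := by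
  obtain ⟨p₁, p₂, rfl⟩ := List.append_of_mem he
  obtain ⟨f, hf, h⟩ := (isPath_append_cons.1 hp).1.exists_mem_head_eq ha
  exact ⟨f, List.mem_append_left _ hf, h⟩

theorem IsPath.exists_mem_tail_eq_head (hp : Γ.IsPath a p b) (he : e ∈ p) (hb : Γ.head e ≠ b) :
    ∃ f ∈ p, Γ.tail f = Γ.head e := by
  obtain ⟨p₁, p₂, rfl⟩ := List.append_of_mem he
  obtain ⟨f, hf, h⟩ := (isPath_append_cons.1 hp).2.exists_mem_tail_eq hb
  exact ⟨f, List.mem_append_right _ (List.mem_cons_of_mem e hf), h⟩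

variable {k : Fin m} {j : Fin n} (hp : Γ.IsPath (.source k) p (.sink j))
include hp

theorem IsPath.exists_mem_head_iff_exists_mem_tail :
    (∃ e ∈ p, Γ.head e = .inner v) ↔ ∃ e ∈ p, Γ.tail e = .inner v := by
  constructor
  · rintro ⟨e, he, hv⟩
    exact hv ▸ hp.exists_mem_tail_eq_head he (by simp [hv])
  · rintro ⟨e, he, hv⟩
    exact hv ▸ hp.exists_mem_head_eq_tail he (by simp [hv])

theorem IsPath.mem_iff_of_isWhite [Fintype E] (hP : Γ.IsPerfect) (hE : Γ.IsEmbedded)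
    (h : Γ.IsWhite v x₁ x₂ x₃) : x₃ ∈ p ↔ x₁ ∈ p ∨ x₂ ∈ p := by
  simpa [h.head_eq hP hE, h.tail_eq hP hE, and_or_left, exists_or] using
    hp.exists_mem_head_iff_exists_mem_tail (v := v)

theorem IsPath.mem_iff_of_isBlack [Fintype E] (hP : Γ.IsPerfect) (hE : Γ.IsEmbedded)
    (h : Γ.IsBlack v y₁ y₂ y₃) : y₃ ∈ p ↔ y₁ ∈ p ∨ y₂ ∈ p := by
  simpa [h.head_eq hP hE, h.tail_eq hP hE, and_or_left, exists_or] using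
    (hp.exists_mem_head_iff_exists_mem_tail (v := v)).symm

theorem IsPath.sourceEdge_mem_iff (hP : Γ.IsPerfect) {i : Fin m} :
    hP.sourceEdge i ∈ p ↔ i = k := by
  constructor
  · intro h
    by_contra hik
    obtain ⟨f, -, hf⟩ := hp.exists_mem_head_eq_tail h
      (by simpa [hP.tail_sourceEdge] using Ne.symm hik)
    exact hP.source_out i f (hf.trans (hP.tail_sourceEdge i))
  · rintro rfl
    obtain ⟨f, hfp, hf⟩ := hp.exists_mem_tail_eq (by simp)
    exact hP.tail_eq_source.1 hf ▸ hfp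

theorem IsPath.sinkEdge_mem_iff (hP : Γ.IsPerfect) {l : Fin n} : hP.sinkEdge l ∈ p ↔ l = j := by
  constructor
  · intro h
    by_contra hlj
    obtain ⟨f, -, hf⟩ := hp.exists_mem_tail_eq_head h (by simpa [hP.head_sinkEdge] using hlj)
    exact hP.sink_in l f (hf.trans (hP.head_sinkEdge l))
  · rintro rfl
    obtain ⟨f, hfp, hf⟩ := hp.exists_mem_head_eq (by simp)
    exact hP.head_eq_sink.1 hf ▸ hfp

end PathsThrough

end Vertices

/-! ### Coefficients of the `r`-matrix -/

section Coefficients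

variable {k : Type*} [Field k]

/-- The spectral factor `lam ^ d(p') * mu ^ d(q')` of the paths `p'` and `q'` obtained from paths
`p` and `q` of indices `A` and `B` by exchanging initial segments whose indices differ by `h`. -/
noncomputable def crossWeight (lam mu : k) (A B h : ℤ) : k := lam ^ (A - h) * mu ^ (B + h)

/-- A function of half-integers whose differences over steps of length `1 / 2` are half the values
of `crossWeight` at the integral ends of the steps. -/
noncomputable def halfStep (lam mu : k) (A B : ℤ) (x : ℚ) : k :=
  (if x = ⌊x⌋ then (1 / 2) * ((mu + lam) / (mu - lam)) else mu / (mu - lam)) *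
    crossWeight lam mu A B ⌊x⌋

theorem halfStep_intCast (lam mu : k) (A B h : ℤ) : halfStep lam mu A B h =
    (1 / 2) * ((mu + lam) / (mu - lam)) * crossWeight lam mu A B h := by
  simp [halfStep]

theorem halfStep_add_half (lam mu : k) (A B h : ℤ) :
    halfStep lam mu A B (h + 1 / 2) = mu / (mu - lam) * crossWeight lam mu A B h := by
  have hfloor : ⌊(h : ℚ) + 1 / 2⌋ = h := by rw [Int.floor_eq_iff]; constructor <;> linarith
  rw [halfStep, hfloor, if_neg (by linarith)]

section NonDegenerate

variable {lam mu : k} (hlam : lam ≠ 0) (hmu : mu ≠ 0) (hne : lam ≠ mu)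

include hlam hmu in
theorem halfStep_sub_half (A B h : ℤ) :
    halfStep lam mu A B (h - 1 / 2) = lam / (mu - lam) * crossWeight lam mu A B h := by
  have hshift : (h : ℚ) - 1 / 2 = ((h - 1 : ℤ) : ℚ) + 1 / 2 := by push_cast; ring
  rw [hshift, halfStep_add_half, crossWeight, crossWeight, show A - (h - 1) = A - h + 1 by ring,
    show B + h = B + (h - 1) + 1 by ring, zpow_add_one₀ hlam, zpow_add_one₀ hmu]
  ring

include hne in
theorem halfStep_sub_halfStep_add_half [NeZero (2 : k)] (A B h : ℤ) :
    halfStep lam mu A B h - halfStep lam mu A B (h + 1 / 2) =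
      -(1 / 2 * crossWeight lam mu A B h) := by
  rw [halfStep_intCast, halfStep_add_half]
  have := sub_ne_zero.2 hne.symm
  have := two_ne_zero (α := k)
  field_simp
  ring

include hlam hmu hne in
theorem halfStep_sub_halfStep_sub_half [NeZero (2 : k)] (A B h : ℤ) :
    halfStep lam mu A B h - halfStep lam mu A B (h - 1 / 2) =
      1 / 2 * crossWeight lam mu A B h := by
  rw [halfStep_intCast, halfStep_sub_half hlam hmu]
  have := sub_ne_zero.2 hne.symm
  have := two_ne_zero (α := k)
  field_simp
  ring

/-- The coefficient of `E a b ⊠ E b a` in the trigonometric `r`-matrix. -/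
noncomputable def trigCoeff {ι : Type*} [LinearOrder ι] (lam mu : k) (a b : ι) : k :=
  if a = b then (1 / 2) * ((mu + lam) / (mu - lam))
  else if a < b then lam / (mu - lam) else mu / (mu - lam)

include hlam hmu in
theorem halfStep_eq_trigCoeff {ι : Type*} [LinearOrder ι] (A B h : ℤ) (a b : ι) :
    halfStep lam mu A B (h + ((if b < a then 1 else 0) - (if a < b then 1 else 0)) / 2) =
      trigCoeff lam mu a b * crossWeight lam mu A B h := by
  unfold trigCoeff
  rcases lt_trichotomy a b with hab | rfl | hab
  · rw [if_neg hab.not_gt, if_pos hab, if_neg hab.ne, if_pos hab,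
      ← halfStep_sub_half hlam hmu]
    congr 1
    ring
  · simp [halfStep_intCast]
  · rw [if_pos hab, if_neg hab.not_gt, if_neg hab.ne', if_neg hab.not_gt, ← halfStep_add_half]
    congr 1
    ring

end NonDegenerate

theorem zero_sub_eq_sum_of_sub_finRotate {M : Type*} [AddCommGroup M] {N : ℕ} [NeZero N]
    {x c : Fin N → M} (hx : ∀ i, x i - x (finRotate N i) = c i) (i : Fin N) :
    x 0 - x i = ∑ j with j < i, c j := by
  obtain ⟨N, rfl⟩ := Nat.exists_eq_succ_of_ne_zero (NeZero.ne N)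
  induction i using Fin.induction with
  | zero => simp
  | succ i ih =>
    have hinsert : ({j | j < i.succ} : Finset (Fin (N + 1))) =
        insert i.castSucc ({j | j < i.castSucc} : Finset (Fin (N + 1))) := by
      ext j
      simp [Fin.lt_def, Fin.ext_iff, le_iff_eq_or_lt]
    rw [hinsert, Finset.sum_insert (by simp), ← ih, ← hx, finRotate_apply, Fin.coeSucc_eq_succ]
    abel

theorem zero_sub_mean_eq {N : ℕ} [NeZero N] {x y : Fin N → ℚ} {a b : Fin N}
    (hrot : ∀ i, x (finRotate N i) = y i)
    (hxy : ∀ i, x i - y i = (if i = a then 1 else 0) - (if i = b then 1 else 0)) :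
    x 0 - (x a + y a) / 2 = ((if a < b then 1 else 0) - (if b < a then 1 else 0)) / 2 := by
  have hx := zero_sub_eq_sum_of_sub_finRotate (fun i => (hrot i).symm ▸ hxy i) a
  simp only [Finset.sum_sub_distrib, Finset.sum_ite_eq', Finset.mem_filter, Finset.mem_univ,
    true_and, lt_irrefl, if_false] at hx
  have hya := hxy a
  rcases lt_trichotomy a b with h | rfl | h
  · simp only [h.ne, h, h.not_gt, if_true, if_false] at hx hya ⊢
    linarith
  · simp only [lt_irrefl, if_true, if_false] at hx hya ⊢
    linarith
  · simp only [h.ne', h, h.not_gt, if_true, if_false] at hx hya ⊢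
    linarith

end Coefficients

/-! ### The flow of a pair of paths -/

section Flow

section Crossing

variable {E : Type*} {p q : List E}

open Classical in
theorem pathDiff_of_nodup (hp : p.Nodup) (hq : q.Nodup) (e : E) :
    pathDiff p q e = (if e ∈ p then 1 else 0) - (if e ∈ q then 1 else 0) := by
  simp [pathDiff, List.Nodup.count hp, List.Nodup.count hq]

open Classical in
/-- The signed number of ways in which `p` and `q` use the edges `x` and `y`:
`1` if `p` uses `x` and `q` uses `y`, minus `1` if `p` uses `y` and `q` uses `x`. -/
noncomputable def crossing (p q : List E) (x y : E) : ℤ :=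
  (if x ∈ p ∧ y ∈ q then 1 else 0) - (if y ∈ p ∧ x ∈ q then 1 else 0)

end Crossing

open Classical in
theorem sum_filter_eq_or_eq {E M : Type*} [AddCommMonoid M] {x y : E} (hxy : x ≠ y) (s : Finset E)
    (g : E → M) : ∑ e ∈ s with e = x ∨ e = y, g e =
      (if x ∈ s then g x else 0) + if y ∈ s then g y else 0 := by
  rw [Finset.filter_or, Finset.sum_union (Finset.disjoint_filter.2 fun e _ hx hy =>
    hxy (hx.symm.trans hy)), Finset.sum_filter, Finset.sum_filter, Finset.sum_ite_eq',
    Finset.sum_ite_eq']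

variable {m n : ℕ} {V E : Type*} {Γ : CylNetwork m n V E} {p q : List E}

variable (Γ) in
open Classical in
/-- The index of the part of the path `p` that precedes its visit to the vertex `a`. -/
noncomputable def indexTo (p : List E) (a : NetVertex m n V) : ℤ :=
  Γ.index (p.takeWhile fun e => Γ.tail e ≠ a)

theorem indexTo_append (hA : Γ.IsAcyclic) {a b c : NetVertex m n V} {p₁ p₂ : List E}
    (hp₁ : Γ.IsPath a p₁ c) (hp₂ : Γ.IsPath c p₂ b) :
    Γ.indexTo (p₁ ++ p₂) c = Γ.index p₁ := by
  classical
  have hinitial (e : E) (he : e ∈ p₁) : Γ.tail e ≠ c := fun h =>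
    hA.not_reaches_head_tail e (h ▸ hp₁.head_reaches he)
  rw [indexTo, List.takeWhile_append_of_pos fun e he => decide_eq_true (hinitial e he)]
  cases p₂ with
  | nil => rw [List.takeWhile_nil, List.append_nil]
  | cons e p₂ =>
    rw [List.takeWhile_cons_of_neg (by simp [hp₂.1]), List.append_nil]

theorem IsPath.indexTo_head (hA : Γ.IsAcyclic) {a b : NetVertex m n V} (hp : Γ.IsPath a p b) {e : E}
    (he : e ∈ p) : Γ.indexTo p (Γ.head e) = Γ.indexTo p (Γ.tail e) + Γ.index [e] := by
  obtain ⟨p₁, p₂, rfl⟩ := List.append_of_mem he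
  obtain ⟨hp₁, hp₂⟩ := isPath_append_cons.1 hp
  have hhead := indexTo_append hA (hp₁.append (q := [e]) ⟨rfl, rfl⟩) hp₂
  rwa [List.append_assoc, List.singleton_append, index_append,
    ← indexTo_append (p₂ := e :: p₂) hA hp₁ ⟨rfl, hp₂⟩] at hhead

variable (Γ) in
open Classical in
/-- The `crossing` of `p` and `q` at the internal vertex `v`, through the first two edges of `v`:
the outgoing edges of a white vertex, or the incoming edges of a black one. -/
noncomputable def crossingAt [Fintype E] (p q : List E) (v : V) : ℤ :=
  ∑ x₁, ∑ x₂, ∑ x₃, ((if Γ.IsWhite v x₁ x₂ x₃ then crossing p q x₁ x₂ else 0) +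
    if Γ.IsBlack v x₁ x₂ x₃ then crossing p q x₁ x₂ else 0)

theorem IsWhite.crossingAt_eq [Fintype E] {v : V} {x₁ x₂ x₃ : E}
    (h : Γ.IsWhite v x₁ x₂ x₃) (hP : Γ.IsPerfect) (hE : Γ.IsEmbedded) :
    Γ.crossingAt p q v = crossing p q x₁ x₂ :=
  h.sum_eq hP hE (fun x₁ x₂ _ => crossing p q x₁ x₂) _

theorem IsBlack.crossingAt_eq [Fintype E] {v : V} {x₁ x₂ x₃ : E}
    (h : Γ.IsBlack v x₁ x₂ x₃) (hP : Γ.IsPerfect) (hE : Γ.IsEmbedded) :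
    Γ.crossingAt p q v = crossing p q x₁ x₂ :=
  h.sum_eq hP hE (fun x₁ x₂ _ => crossing p q x₁ x₂) _

section Shared

variable [Fintype E] [NeZero m] [NeZero n] {u : E × Bool → ℚ} {e : E} {k i : Fin m} {j l : Fin n}
  (hu : Γ.IsPotential u (pathDiff p q)) (hΓ : Γ.IsPerfectCylindrical)
  (hp : Γ.IsPath (.source k) p (.sink j)) (hq : Γ.IsPath (.source i) q (.sink l))
  (hep : e ∈ p) (heq : e ∈ q)
include hu hp hq hep heq

theorem IsPotential.source_sub_eq_indexTo_tail : u (hΓ.perfect.sourceEdge 0, true) - u (e, true) =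
    Γ.indexTo p (Γ.tail e) - Γ.indexTo q (Γ.tail e) := by
  obtain ⟨p₁, p₂, rfl⟩ := List.append_of_mem hep
  obtain ⟨q₁, q₂, rfl⟩ := List.append_of_mem heq
  obtain ⟨hp₁, hp₂⟩ := isPath_append_cons.1 hp
  obtain ⟨hq₁, hq₂⟩ := isPath_append_cons.1 hq
  rw [hu.source_sub_eq_index hΓ hp hq, indexTo_append (p₂ := e :: p₂) hΓ.acyclic hp₁ ⟨rfl, hp₂⟩,
    indexTo_append (p₂ := e :: q₂) hΓ.acyclic hq₁ ⟨rfl, hq₂⟩]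

theorem IsPotential.source_sub_eq_indexTo_head : u (hΓ.perfect.sourceEdge 0, true) - u (e, true) =
    Γ.indexTo p (Γ.head e) - Γ.indexTo q (Γ.head e) := by
  rw [hu.source_sub_eq_indexTo_tail hΓ hp hq hep heq, hp.indexTo_head hΓ.acyclic hep,
    hq.indexTo_head hΓ.acyclic heq]
  push_cast
  ring

end Shared

section Flux

variable {M : Type*} [AddCommGroup M]

variable (Γ) in
open Classical in
/-- What the edges of `p` entering `a` carry, minus what the edges of `p` leaving `a` carry. -/
noncomputable def flux (g : E → M) (p : List E) (a : NetVertex m n V) : M :=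
  ∑ e ∈ p.toFinset with Γ.head e = a, g e - ∑ e ∈ p.toFinset with Γ.tail e = a, g e

open Classical in
theorem sum_sum_filter_eq_inner [Fintype V] (g : E → M) {f : E → NetVertex m n V} {s : Finset E}
    {e₀ : E} (he₀ : e₀ ∈ s) (hf : ∀ e ∈ s, (∃ v, f e = .inner v) ↔ e ≠ e₀) :
    ∑ v, ∑ e ∈ s with f e = .inner v, g e = ∑ e ∈ s, g e - g e₀ := by
  simp_rw [Finset.sum_filter]
  rw [Finset.sum_comm, eq_sub_iff_add_eq, ← Finset.sum_erase_add s g he₀,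
    ← Finset.sum_erase_add s _ he₀]
  have hzero (v : V) : f e₀ ≠ .inner v := fun h => (hf e₀ he₀).1 ⟨v, h⟩ rfl
  simp only [hzero, if_false, Finset.sum_const_zero, add_zero, add_left_inj]
  refine Finset.sum_congr rfl fun e he => ?_
  obtain ⟨v, hv⟩ := (hf e (Finset.mem_of_mem_erase he)).2 (Finset.ne_of_mem_erase he)
  simp [hv]

theorem IsPerfect.sum_flux_inner [Fintype V] (hP : Γ.IsPerfect) (g : E → M) {i : Fin m}
    {j : Fin n} (hp : Γ.IsPath (.source i) p (.sink j)) :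
    ∑ v, Γ.flux g p (.inner v) = g (hP.sourceEdge i) - g (hP.sinkEdge j) := by
  classical
  have hhead (e : E) (he : e ∈ p) : (∃ v, Γ.head e = .inner v) ↔ e ≠ hP.sinkEdge j := by
    rcases h : Γ.head e with l | v | l
    · exact absurd h (hP.source_out l e)
    · have hne : e ≠ hP.sinkEdge j := by rintro rfl; simp [hP.head_sinkEdge] at h
      simpa using hne
    · obtain rfl := hP.head_eq_sink.1 h
      simp [(hp.sinkEdge_mem_iff hP).1 he]
  have htail (e : E) (he : e ∈ p) : (∃ v, Γ.tail e = .inner v) ↔ e ≠ hP.sourceEdge i := by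
    rcases h : Γ.tail e with l | v | l
    · obtain rfl := hP.tail_eq_source.1 h
      simp [(hp.sourceEdge_mem_iff hP).1 he]
    · have hne : e ≠ hP.sourceEdge i := by rintro rfl; simp [hP.tail_sourceEdge] at h
      simpa using hne
    · exact absurd h (hP.sink_in l e)
  simp only [flux, Finset.sum_sub_distrib]
  rw [sum_sum_filter_eq_inner g (List.mem_toFinset.2 ((hp.sinkEdge_mem_iff hP).2 rfl))
      (by simpa only [List.mem_toFinset] using hhead),
    sum_sum_filter_eq_inner g (List.mem_toFinset.2 ((hp.sourceEdge_mem_iff hP).2 rfl))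
      (by simpa only [List.mem_toFinset] using htail)]
  abel

end Flux

section Conservation

variable {k : Type*} [Field k] {lam mu : k} {u : E × Bool → ℚ}

/-- What the edge `e` carries: the value of `halfStep` at the drop of `u` from `c` to the mean of
its values on the two sides of `e`. -/
noncomputable def flow (lam mu : k) (A B : ℤ) (u : E × Bool → ℚ) (c : ℚ) (e : E) : k :=
  halfStep lam mu A B (c - (u (e, true) + u (e, false)) / 2)

section Ends

variable [Fintype E] [NeZero m] (hlam : lam ≠ 0) (hmu : mu ≠ 0) (hΓ : Γ.IsPerfectCylindrical)
  {i i' : Fin m} {j j' : Fin n} (hp : Γ.IsPath (.source i) p (.sink j))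
  (hq : Γ.IsPath (.source i') q (.sink j')) (hu : Γ.IsPotential u (pathDiff p q))
include hlam hmu hp hq hu

theorem IsPotential.flow_sourceEdge (A B : ℤ) :
    flow lam mu A B u (u (hΓ.perfect.sourceEdge 0, true)) (hΓ.perfect.sourceEdge i) =
      trigCoeff lam mu i' i * (lam ^ A * mu ^ B) := by
  classical
  obtain ⟨hP, hE, -, hA⟩ := id hΓ
  have hmean := zero_sub_mean_eq (x := fun i => u (hP.sourceEdge i, true))
    (y := fun i => u (hP.sourceEdge i, false)) (a := i) (b := i')
    (fun i => (hu.rev_eq_of_rot_eq (hP.rot_sourceEdge hE i)).symm)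
    (fun i => by rw [hu.sub_eq, pathDiff_of_nodup (Γ.nodup_of_isPath hA hp)
      (Γ.nodup_of_isPath hA hq)]; simp only [hp.sourceEdge_mem_iff, hq.sourceEdge_mem_iff])
  have hcoeff := halfStep_eq_trigCoeff hlam hmu A B 0 i' i
  rwa [Int.cast_zero, zero_add, ← hmean, crossWeight, sub_zero, add_zero] at hcoeff

theorem IsPotential.flow_sinkEdge [NeZero n] (A B : ℤ) :
    flow lam mu A B u (u (hΓ.perfect.sourceEdge 0, true)) (hΓ.perfect.sinkEdge j) =
      trigCoeff lam mu j' j * crossWeight lam mu A B (Γ.index p - Γ.index q) := by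
  classical
  obtain ⟨hP, hE, hC, hA⟩ := id hΓ
  have hmean := zero_sub_mean_eq (x := fun j => u (hP.sinkEdge j, true))
    (y := fun j => u (hP.sinkEdge j, false)) (a := j) (b := j')
    (fun j => hu.rev_eq_of_rot_eq (hP.rot_sinkEdge hE j))
    (fun j => by rw [hu.sub_eq, pathDiff_of_nodup (Γ.nodup_of_isPath hA hp)
      (Γ.nodup_of_isPath hA hq)]; simp only [hp.sinkEdge_mem_iff, hq.sinkEdge_mem_iff])
  have hcut := hu.source_sub_sink_eq_index hP hC
  rw [← halfStep_eq_trigCoeff hlam hmu, ← hmean, flow, Int.cast_sub, ← hcut]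
  congr 1
  ring

end Ends

variable [NeZero (2 : k)] (hlam : lam ≠ 0) (hmu : mu ≠ 0) (hne : lam ≠ mu)
include hlam hmu hne

open Classical in
/-- `t` is the trunk of a fork with branches `x` (on the left) and `y` (on the right). -/
theorem IsPotential.flow_trunk_sub_branches (hp : p.Nodup) (hq : q.Nodup)
    (hu : Γ.IsPotential u (pathDiff p q)) {t x y : E} {c : ℚ} {A B h : ℤ}
    (hleft : u (x, true) = u (t, true)) (hmid : u (x, false) = u (y, true))
    (hright : u (y, false) = u (t, false)) (htp : t ∈ p ↔ x ∈ p ∨ y ∈ p)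
    (htq : t ∈ q ↔ x ∈ q ∨ y ∈ q) (hxyp : ¬ (x ∈ p ∧ y ∈ p)) (hxyq : ¬ (x ∈ q ∧ y ∈ q))
    (hc : t ∈ p → t ∈ q → c - u (t, true) = h) :
    (if t ∈ p then flow lam mu A B u c t else 0) -
        ((if x ∈ p then flow lam mu A B u c x else 0) +
          if y ∈ p then flow lam mu A B u c y else 0) =
      1 / 2 * (crossing p q y x * crossWeight lam mu A B h) := by
  have hx := hu.sub_eq x
  have hy := hu.sub_eq y
  rw [pathDiff_of_nodup hp hq] at hx hy
  unfold flow
  by_cases hxp : x ∈ p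
  · have hyp : y ∉ p := fun hyp => hxyp ⟨hxp, hyp⟩
    by_cases hyq : y ∈ q
    · have hxq : x ∉ q := fun hxq => hxyq ⟨hxq, hyq⟩
      have hc := hc (htp.2 (.inl hxp)) (htq.2 (.inr hyq))
      simp only [hxp, hyp, hxq, hyq, if_true, if_false] at hx hy
      rw [if_pos (htp.2 (.inl hxp)), if_pos hxp, if_neg hyp, add_zero,
        show c - (u (t, true) + u (t, false)) / 2 = h by linarith,
        show c - (u (x, true) + u (x, false)) / 2 = h + 1 / 2 by linarith,
        halfStep_sub_halfStep_add_half hne]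
      simp [crossing, hxp, hyp, hyq]
    · simp only [hyp, hyq, if_false] at hy
      rw [show u (x, true) + u (x, false) = u (t, true) + u (t, false) by linarith]
      simp [crossing, htp, hxp, hyp, hyq]
  · by_cases hyp : y ∈ p
    · by_cases hxq : x ∈ q
      · have hyq : y ∉ q := fun hyq => hxyq ⟨hxq, hyq⟩
        have hc := hc (htp.2 (.inr hyp)) (htq.2 (.inl hxq))
        simp only [hxp, hyp, hxq, hyq, if_true, if_false] at hx hy
        rw [if_pos (htp.2 (.inr hyp)), if_neg hxp, if_pos hyp, zero_add,
          show c - (u (t, true) + u (t, false)) / 2 = h by linarith,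
          show c - (u (y, true) + u (y, false)) / 2 = h - 1 / 2 by linarith,
          halfStep_sub_halfStep_sub_half hlam hmu hne]
        simp [crossing, hxp, hyp, hxq]
      · simp only [hxp, hxq, if_false] at hx
        rw [show u (y, true) + u (y, false) = u (t, true) + u (t, false) by linarith]
        simp [crossing, htp, hxp, hyp, hxq]
    · simp [crossing, htp, hxp, hyp]

section Vertex

variable [Fintype E] [NeZero m] [NeZero n] (hΓ : Γ.IsPerfectCylindrical) {i i' : Fin m}
  {j j' : Fin n} (hp : Γ.IsPath (.source i) p (.sink j)) (hq : Γ.IsPath (.source i') q (.sink j'))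
  (hu : Γ.IsPotential u (pathDiff p q)) {v : V} {x₁ x₂ x₃ : E}
include hp hq hu

theorem IsWhite.flux_flow (h : Γ.IsWhite v x₁ x₂ x₃) :
    Γ.flux (flow lam mu (Γ.index p) (Γ.index q) u (u (hΓ.perfect.sourceEdge 0, true))) p
        (.inner v) =
      1 / 2 * (crossing p q x₁ x₂ * crossWeight lam mu (Γ.index p) (Γ.index q)
        (Γ.indexTo p (.inner v) - Γ.indexTo q (.inner v))) := by
  classical
  obtain ⟨hP, hE, -, hA⟩ := id hΓ
  have htail : Γ.tail x₁ = Γ.tail x₂ :=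
    ((h.tail_eq hP hE).2 (.inl rfl)).trans ((h.tail_eq hP hE).2 (.inr rfl)).symm
  rw [← hu.flow_trunk_sub_branches hlam hmu hne (Γ.nodup_of_isPath hA hp)
    (Γ.nodup_of_isPath hA hq) (c := u (hΓ.perfect.sourceEdge 0, true))
    (t := x₃) (x := x₂) (y := x₁)]
  · simp only [flux, h.head_eq hP hE, h.tail_eq hP hE, sum_filter_eq_or_eq (h.ne hP hE),
      Finset.sum_filter, Finset.sum_ite_eq', List.mem_toFinset, add_comm]
  · exact (hu.rev_eq_of_rot_eq h.2.2.2).symm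
  · exact hu.rev_eq_of_rot_eq h.2.2.1
  · exact hu.rev_eq_of_rot_eq h.2.1
  · exact (hp.mem_iff_of_isWhite hP hE h).trans or_comm
  · exact (hq.mem_iff_of_isWhite hP hE h).trans or_comm
  · exact fun hx => h.ne hP hE (hp.eq_of_tail_eq hA hx.2 hx.1 htail)
  · exact fun hx => h.ne hP hE (hq.eq_of_tail_eq hA hx.2 hx.1 htail)
  · intro hx₃p hx₃q
    rw [hu.source_sub_eq_indexTo_head hΓ hp hq hx₃p hx₃q, h.1, Int.cast_sub]

theorem IsBlack.flux_flow (h : Γ.IsBlack v x₁ x₂ x₃) :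
    Γ.flux (flow lam mu (Γ.index p) (Γ.index q) u (u (hΓ.perfect.sourceEdge 0, true))) p
        (.inner v) =
      1 / 2 * (crossing p q x₁ x₂ * crossWeight lam mu (Γ.index p) (Γ.index q)
        (Γ.indexTo p (.inner v) - Γ.indexTo q (.inner v))) := by
  classical
  obtain ⟨hP, hE, -, hA⟩ := id hΓ
  have hhead : Γ.head x₁ = Γ.head x₂ :=
    ((h.head_eq hP hE).2 (.inl rfl)).trans ((h.head_eq hP hE).2 (.inr rfl)).symm
  have hanti : crossing p q x₁ x₂ = -crossing p q x₂ x₁ := (neg_sub _ _).symm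
  rw [hanti, Int.cast_neg, neg_mul, mul_neg, ← hu.flow_trunk_sub_branches hlam hmu hne
    (Γ.nodup_of_isPath hA hp) (Γ.nodup_of_isPath hA hq) (c := u (hΓ.perfect.sourceEdge 0, true))
    (t := x₃) (x := x₁) (y := x₂)]
  · simp only [flux, h.head_eq hP hE, h.tail_eq hP hE, sum_filter_eq_or_eq (h.ne hP hE),
      Finset.sum_filter, Finset.sum_ite_eq', List.mem_toFinset, neg_sub]
  · exact hu.rev_eq_of_rot_eq h.2.1
  · exact (hu.rev_eq_of_rot_eq h.2.2.1).symm
  · exact (hu.rev_eq_of_rot_eq h.2.2.2).symm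
  · exact hp.mem_iff_of_isBlack hP hE h
  · exact hq.mem_iff_of_isBlack hP hE h
  · exact fun hx => h.ne hP hE (hp.eq_of_head_eq hA hx.1 hx.2 hhead)
  · exact fun hx => h.ne hP hE (hq.eq_of_head_eq hA hx.1 hx.2 hhead)
  · intro hx₃p hx₃q
    rw [hu.source_sub_eq_indexTo_tail hΓ hp hq hx₃p hx₃q, h.1, Int.cast_sub]

end Vertex

theorem IsPerfectCylindrical.sum_crossingAt [Fintype V] [Fintype E]
    (hΓ : Γ.IsPerfectCylindrical) {i i' : Fin m} {j j' : Fin n}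
    (hp : Γ.IsPath (.source i) p (.sink j)) (hq : Γ.IsPath (.source i') q (.sink j')) :
    ∑ v, 1 / 2 * (Γ.crossingAt p q v * crossWeight lam mu (Γ.index p) (Γ.index q)
        (Γ.indexTo p (.inner v) - Γ.indexTo q (.inner v))) =
      trigCoeff lam mu i' i * (lam ^ Γ.index p * mu ^ Γ.index q) -
        trigCoeff lam mu j' j * (mu ^ Γ.index p * lam ^ Γ.index q) := by
  have : NeZero m := ⟨i.pos.ne'⟩
  have : NeZero n := ⟨j.pos.ne'⟩
  obtain ⟨u, hu⟩ := hΓ.perfect.exists_isPotential_pathDiff hΓ.embedded hp hq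
    fun X hsource hsink => by rw [hsource i i', hsink j j']
  have hflux := hΓ.perfect.sum_flux_inner (flow lam mu (Γ.index p) (Γ.index q) u
    (u (hΓ.perfect.sourceEdge 0, true))) hp
  rw [hu.flow_sourceEdge hlam hmu hΓ hp hq, hu.flow_sinkEdge hlam hmu hΓ hp hq, crossWeight,
    sub_sub_cancel, add_sub_cancel, mul_comm (lam ^ Γ.index q)] at hflux
  rw [← hflux]
  refine Finset.sum_congr rfl fun v _ => ?_
  rcases hΓ.perfect.isWhite_or_isBlack hΓ.embedded v with ⟨x₁, x₂, x₃, h⟩ | ⟨x₁, x₂, x₃, h⟩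
  · rw [h.crossingAt_eq hΓ.perfect hΓ.embedded, h.flux_flow hlam hmu hne hΓ hp hq hu]
  · rw [h.crossingAt_eq hΓ.perfect hΓ.embedded, h.flux_flow hlam hmu hne hΓ hp hq hu]

end Conservation

end Flow

/-! ### Generating functions of paths -/

section PathSums

variable {m n : ℕ} {V E : Type*} {Γ : CylNetwork m n V E}

section Paths

variable [Finite E] (hA : Γ.IsAcyclic)

/-- The finite set of paths between two vertices. -/
noncomputable def paths (a b : NetVertex m n V) : Finset (List E) :=
  (Γ.finite_isPath hA a b).toFinset

theorem mem_paths {a b : NetVertex m n V} {p : List E} : p ∈ paths hA a b ↔ Γ.IsPath a p b := by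
  simp [paths]

theorem paths_self (a : NetVertex m n V) : paths hA a a = {[]} := by
  ext p
  rw [mem_paths, Finset.mem_singleton]
  exact ⟨hA a p, by rintro rfl; rfl⟩

variable {M : Type*} [AddCommMonoid M]

open Classical in
theorem sum_paths_through (e : E) (a b : NetVertex m n V) (F : List E → M) :
    ∑ p ∈ paths hA a b, (if e ∈ p then F p else 0) =
      ∑ q ∈ paths hA a (Γ.tail e), ∑ r ∈ paths hA (Γ.head e) b, F (q ++ e :: r) := by
  rw [← Finset.sum_product', ← Finset.sum_filter]
  symm
  refine Finset.sum_bij (fun x _ => x.1 ++ e :: x.2) ?_ ?_ ?_ fun _ _ => rfl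
  · rintro ⟨q, r⟩ h
    rw [Finset.mem_product, mem_paths, mem_paths] at h
    rw [Finset.mem_filter, mem_paths]
    exact ⟨isPath_append_cons.2 h, by simp⟩
  · rintro ⟨q, r⟩ h ⟨q', r'⟩ h' heq
    rw [Finset.mem_product] at h h'
    have hq : e ∉ q := fun he =>
      hA.not_reaches_head_tail e (((mem_paths hA).1 h.1).head_reaches he)
    have hr : e ∉ r := fun he =>
      hA.not_reaches_head_tail e (((mem_paths hA).1 h.2).reaches_tail he)
    obtain ⟨rfl, -, rfl⟩ := (List.append_cons_inj_of_notMem hq hr).1 heq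
    rfl
  · intro p hp
    rw [Finset.mem_filter, mem_paths] at hp
    obtain ⟨q, r, rfl⟩ := List.append_of_mem hp.2
    refine ⟨(q, r), ?_, rfl⟩
    rw [Finset.mem_product, mem_paths, mem_paths]
    exact isPath_append_cons.1 hp.1

open Classical in
theorem sum_paths_eq_sum_tail [Fintype E] {a b : NetVertex m n V} (hab : a ≠ b)
    (F : List E → M) : ∑ p ∈ paths hA a b, F p =
      ∑ e with Γ.tail e = a, ∑ r ∈ paths hA (Γ.head e) b, F (e :: r) := by
  have hthrough (p : List E) (hp : p ∈ paths hA a b) :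
      F p = ∑ e with Γ.tail e = a, if e ∈ p then F p else 0 := by
    rw [mem_paths] at hp
    obtain ⟨e, hep, he⟩ := hp.exists_mem_tail_eq hab
    rw [Finset.sum_eq_single_of_mem e (by simpa using he), if_pos hep]
    exact fun f hf hfe => if_neg fun hfp =>
      hfe (hp.eq_of_tail_eq hA hfp hep ((Finset.mem_filter.1 hf).2.trans he.symm))
  rw [Finset.sum_congr rfl hthrough, Finset.sum_comm]
  refine Finset.sum_congr rfl fun e he => ?_
  obtain rfl := (Finset.mem_filter.1 he).2
  rw [sum_paths_through, paths_self, Finset.sum_singleton]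
  rfl

open Classical in
theorem sum_paths_eq_sum_head [Fintype E] {a b : NetVertex m n V} (hab : a ≠ b)
    (F : List E → M) : ∑ p ∈ paths hA a b, F p =
      ∑ e with Γ.head e = b, ∑ q ∈ paths hA a (Γ.tail e), F (q ++ [e]) := by
  have hthrough (p : List E) (hp : p ∈ paths hA a b) :
      F p = ∑ e with Γ.head e = b, if e ∈ p then F p else 0 := by
    rw [mem_paths] at hp
    obtain ⟨e, hep, he⟩ := hp.exists_mem_head_eq hab
    rw [Finset.sum_eq_single_of_mem e (by simpa using he), if_pos hep]
    exact fun f hf hfe => if_neg fun hfp =>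
      hfe (hp.eq_of_head_eq hA hfp hep ((Finset.mem_filter.1 hf).2.trans he.symm))
  rw [Finset.sum_congr rfl hthrough, Finset.sum_comm]
  refine Finset.sum_congr rfl fun e he => ?_
  obtain rfl := (Finset.mem_filter.1 he).2
  simp only [sum_paths_through, paths_self, Finset.sum_singleton]

end Paths

section Algebra

variable {k : Type*} [Field k] [Fintype V]

theorem idAt_mul_idAt (a : NetVertex m n V) : Γ.idAt k a * Γ.idAt k a = Γ.idAt k a := by
  simpa only [map_mul, idAt] using Γ.toAlg_rel (k := k) (.one_mul_one a)

theorem idAt_tail_mul_arr (e : E) : Γ.idAt k (Γ.tail e) * Γ.arr k e = Γ.arr k e := by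
  simpa only [map_mul, idAt, arr] using Γ.toAlg_rel (k := k) (.one_mul_edge e)

theorem arr_mul_idAt_head (e : E) : Γ.arr k e * Γ.idAt k (Γ.head e) = Γ.arr k e := by
  simpa only [map_mul, idAt, arr] using Γ.toAlg_rel (k := k) (.edge_mul_one e)

theorem weight_nil : (Γ.weight [] : Γ.PathAlg k) = 1 := rfl

theorem weight_cons (e : E) (p : List E) :
    (Γ.weight (e :: p) : Γ.PathAlg k) = Γ.arr k e * Γ.weight p := by
  simp [weight]

theorem weight_append (p q : List E) :
    (Γ.weight (p ++ q) : Γ.PathAlg k) = Γ.weight p * Γ.weight q := by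
  simp [weight]

variable (Γ k) in
/-- The morphism of `𝒞` given by a path that starts at `a`: the product of its edges or, for the
empty path, the identity of `a`. -/
noncomputable def pathArr (a : NetVertex m n V) (p : List E) : Γ.PathAlg k :=
  Γ.idAt k a * Γ.weight p

theorem IsPath.pathArr_eq_weight_mul {p : List E} : ∀ {a b : NetVertex m n V}, Γ.IsPath a p b →
    Γ.pathArr k a p = Γ.weight p * Γ.idAt k b := by
  induction p with
  | nil => rintro a b rfl; rw [pathArr, weight_nil, one_mul, mul_one]
  | cons e p ih =>
    rintro a b ⟨rfl, h⟩
    rw [pathArr, weight_cons, mul_assoc, ← ih h, pathArr, ← mul_assoc, idAt_tail_mul_arr,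
      ← mul_assoc, arr_mul_idAt_head]

theorem IsPath.pathArr_mul_idAt {p : List E} {a b : NetVertex m n V} (h : Γ.IsPath a p b) :
    Γ.pathArr k a p * Γ.idAt k b = Γ.pathArr k a p := by
  rw [h.pathArr_eq_weight_mul, mul_assoc, idAt_mul_idAt]

theorem idAt_mul_pathArr (a : NetVertex m n V) (p : List E) :
    Γ.idAt k a * Γ.pathArr k a p = Γ.pathArr k a p := by
  rw [pathArr, ← mul_assoc, idAt_mul_idAt]

theorem pathArr_append_cons (a : NetVertex m n V) (p q : List E) (e : E) :
    Γ.pathArr k a (p ++ e :: q) = Γ.pathArr k a p * Γ.arr k e * Γ.pathArr k (Γ.head e) q := by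
  rw [pathArr, weight_append, weight_cons, pathArr, pathArr, mul_assoc _ (Γ.arr k e),
    ← mul_assoc (Γ.arr k e), arr_mul_idAt_head, mul_assoc]

theorem IsPath.pathArr_eq_weight {p : List E} {a b : NetVertex m n V} (h : Γ.IsPath a p b)
    (hab : a ≠ b) : Γ.pathArr k a p = Γ.weight p := by
  cases p with
  | nil => exact absurd h hab
  | cons e p => rw [pathArr, ← h.1, weight_cons, ← mul_assoc, idAt_tail_mul_arr]

theorem partialHom_arr (e f : E) : Γ.partialHom k e (Γ.arr k f) = Γ.partialGen k e (.edge f) :=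
  (RingQuot.liftAlgHom_mkAlgHom_apply k _ _ _).trans (FreeAlgebra.lift_ι_apply _ _)

theorem partialHom_weight_one_one (e : E) (p : List E) :
    Γ.partialHom k e (Γ.weight p) 1 1 = 1 ⊗ₜ Γ.weight p := by
  have hlower (f : E) : Γ.partialGen k e (.edge f) 1 0 = 0 := rfl
  have hdiag (f : E) : Γ.partialGen k e (.edge f) 1 1 = 1 ⊗ₜ Γ.arr k f := rfl
  induction p with
  | nil => rw [weight_nil, map_one, Matrix.one_apply_eq, Algebra.TensorProduct.one_def]
  | cons f p ih =>
    rw [weight_cons, map_mul, partialHom_arr, Matrix.mul_apply, Fin.sum_univ_two, hlower, hdiag,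
      zero_mul, zero_add, ih, Algebra.TensorProduct.tmul_mul_tmul, one_mul]

theorem partialD_weight_nil (e : E) : Γ.partialD k e (Γ.weight []) = 0 := by
  change Γ.partialHom k e (Γ.weight []) 0 1 = 0
  rw [weight_nil, map_one]
  rfl

open Classical in
theorem partialD_weight_cons (e f : E) (p : List E) :
    Γ.partialD k e (Γ.weight (f :: p)) = (Γ.arr k f ⊗ₜ 1) * Γ.partialD k e (Γ.weight p) +
      (if f = e then Γ.idAt k (Γ.tail f) ⊗ₜ (Γ.idAt k (Γ.head f) * Γ.weight p) else 0) := by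
  change Γ.partialHom k e (Γ.weight (f :: p)) 0 1 =
    _ * Γ.partialHom k e (Γ.weight p) 0 1 + _
  rw [weight_cons, map_mul, partialHom_arr, Matrix.mul_apply, Fin.sum_univ_two,
    partialHom_weight_one_one]
  by_cases h : f = e <;> simp [partialGen, h]

theorem partialD_weight_of_notMem {e : E} {p : List E} (h : e ∉ p) :
    Γ.partialD k e (Γ.weight p) = 0 := by
  induction p with
  | nil => exact partialD_weight_nil e
  | cons f p ih =>
    rw [List.mem_cons, not_or] at h
    rw [partialD_weight_cons, ih h.2, if_neg (Ne.symm h.1), mul_zero, add_zero]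

theorem partialD_weight_append_cons {e : E} {q r : List E} (hq : e ∉ q) (hr : e ∉ r) :
    Γ.partialD k e (Γ.weight (q ++ e :: r)) =
      (Γ.weight q * Γ.idAt k (Γ.tail e)) ⊗ₜ Γ.pathArr k (Γ.head e) r := by
  induction q with
  | nil =>
    rw [List.nil_append, partialD_weight_cons, partialD_weight_of_notMem hr, mul_zero, zero_add,
      if_pos rfl, weight_nil, one_mul, pathArr]
  | cons f q ih =>
    rw [List.mem_cons, not_or] at hq
    rw [List.cons_append, partialD_weight_cons, if_neg (Ne.symm hq.1), ih hq.2, add_zero,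
      Algebra.TensorProduct.tmul_mul_tmul, one_mul, weight_cons, mul_assoc]

variable [Finite E] (hA : Γ.IsAcyclic)

/-- The generating function of the paths between two vertices; between a source and a sink it is
a boundary measurement. -/
noncomputable def pathSum (z : k) (a b : NetVertex m n V) : Γ.PathAlg k :=
  ∑ p ∈ paths hA a b, z ^ Γ.index p • Γ.pathArr k a p

theorem boundaryMeasurement_eq_sum (z : k) (i : Fin m) (j : Fin n) :
    Γ.boundaryMeasurement z i j =
      ∑ p ∈ paths hA (.source i) (.sink j), z ^ Γ.index p • Γ.weight p :=
  finsum_mem_eq_finite_toFinset_sum _ (Γ.finite_isPath hA _ _)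

theorem boundaryMeasurement_eq_pathSum (z : k) (i : Fin m) (j : Fin n) :
    Γ.boundaryMeasurement z i j = pathSum hA z (.source i) (.sink j) := by
  rw [boundaryMeasurement_eq_sum hA]
  refine Finset.sum_congr rfl fun p hp => ?_
  rw [((mem_paths hA).1 hp).pathArr_eq_weight (by simp)]

theorem idAt_mul_pathSum (z : k) (a b : NetVertex m n V) :
    Γ.idAt k a * pathSum hA z a b = pathSum hA z a b := by
  simp only [pathSum, Finset.mul_sum, mul_smul_comm, idAt_mul_pathArr]

theorem pathSum_mul_idAt (z : k) (a b : NetVertex m n V) :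
    pathSum hA z a b * Γ.idAt k b = pathSum hA z a b := by
  simp only [pathSum, Finset.sum_mul, smul_mul_assoc]
  refine Finset.sum_congr rfl fun p hp => ?_
  rw [((mem_paths hA).1 hp).pathArr_mul_idAt]

open Classical in
theorem pathSum_eq_sum_tail [Fintype E] {z : k} (hz : z ≠ 0) {a b : NetVertex m n V}
    (hab : a ≠ b) : pathSum hA z a b =
      ∑ e with Γ.tail e = a, z ^ Γ.index [e] • (Γ.arr k e * pathSum hA z (Γ.head e) b) := by
  rw [pathSum, sum_paths_eq_sum_tail hA hab]
  refine Finset.sum_congr rfl fun e he => ?_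
  obtain rfl := (Finset.mem_filter.1 he).2
  rw [pathSum, Finset.mul_sum, Finset.smul_sum]
  refine Finset.sum_congr rfl fun r _ => ?_
  rw [mul_smul_comm, smul_smul, ← zpow_add₀ hz, ← index_append, List.singleton_append,
    ← List.nil_append (e :: r), pathArr_append_cons, pathArr, weight_nil, mul_one,
    idAt_tail_mul_arr]

open Classical in
theorem pathSum_eq_sum_head [Fintype E] {z : k} (hz : z ≠ 0) {a b : NetVertex m n V}
    (hab : a ≠ b) : pathSum hA z a b =
      ∑ e with Γ.head e = b, z ^ Γ.index [e] • (pathSum hA z a (Γ.tail e) * Γ.arr k e) := by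
  rw [pathSum, sum_paths_eq_sum_head hA hab]
  refine Finset.sum_congr rfl fun e _ => ?_
  rw [pathSum, Finset.sum_mul, Finset.smul_sum]
  refine Finset.sum_congr rfl fun q _ => ?_
  rw [smul_mul_assoc, smul_smul, ← zpow_add₀ hz, add_comm, ← index_append, pathArr, pathArr,
    weight_append, weight_cons, weight_nil, mul_one, mul_assoc]

open Classical in
theorem pathSum_mul_arr_mul_pathSum (z t : k) (e : E) (a b : NetVertex m n V) :
    pathSum hA z a (Γ.tail e) * Γ.arr k e * pathSum hA t (Γ.head e) b =
      ∑ p ∈ paths hA a b, (if e ∈ p then z ^ Γ.indexTo p (Γ.tail e) *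
        t ^ (Γ.index p - Γ.indexTo p (Γ.head e)) else 0) • Γ.pathArr k a p := by
  simp only [ite_zero_smul, sum_paths_through, pathSum, Finset.sum_mul, Finset.mul_sum]
  rw [Finset.sum_comm]
  refine Finset.sum_congr rfl fun q hq => Finset.sum_congr rfl fun r hr => ?_
  rw [mem_paths] at hq hr
  have hqr : Γ.IsPath a (q ++ e :: r) b := isPath_append_cons.2 ⟨hq, hr⟩
  have hindex : Γ.index (q ++ e :: r) = Γ.index q + Γ.index [e] + Γ.index r := by
    rw [← List.singleton_append, index_append, index_append, add_assoc]
  rw [hqr.indexTo_head hA (by simp), indexTo_append (p₂ := e :: r) hA hq ⟨rfl, hr⟩, hindex,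
    add_sub_cancel_left, pathArr_append_cons, smul_mul_assoc, smul_mul_assoc, mul_smul_comm,
    smul_smul]

theorem partialD_boundaryMeasurement {z : k} (hz : z ≠ 0) (e : E) (i : Fin m) (j : Fin n) :
    Γ.partialD k e (Γ.boundaryMeasurement z i j) = z ^ Γ.index [e] •
      pathSum hA z (.source i) (Γ.tail e) ⊗ₜ[k] pathSum hA z (Γ.head e) (.sink j) := by
  classical
  have hthrough (p : List E) : z ^ Γ.index p • Γ.partialD k e (Γ.weight p) =
      if e ∈ p then z ^ Γ.index p • Γ.partialD k e (Γ.weight p) else 0 := by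
    split_ifs with h
    · rfl
    · rw [partialD_weight_of_notMem h, smul_zero]
  simp only [boundaryMeasurement_eq_sum hA, map_sum, map_smul, pathSum, TensorProduct.sum_tmul,
    TensorProduct.tmul_sum, Finset.smul_sum]
  rw [Finset.sum_congr rfl fun p _ => hthrough p, sum_paths_through, Finset.sum_comm]
  refine Finset.sum_congr rfl fun r hr => Finset.sum_congr rfl fun q hq => ?_
  rw [mem_paths] at hq hr
  have he : e ∉ q := fun he => hA.not_reaches_head_tail e (hq.head_reaches he)
  have he' : e ∉ r := fun he => hA.not_reaches_head_tail e (hr.reaches_tail he)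
  rw [partialD_weight_append_cons he he', ← hq.pathArr_eq_weight_mul,
    TensorProduct.smul_tmul_smul, smul_smul, index_append, ← List.singleton_append, index_append,
    zpow_add₀ hz, zpow_add₀ hz, mul_left_comm]

end Algebra

end PathSums

/-! ### The double bracket of boundary measurements -/

section Bracket

variable {m n : ℕ} {V E : Type*} {Γ : CylNetwork m n V E} {k : Type*} [Field k] [Fintype V]

theorem tau_tmul (x y : Γ.PathAlg k) : Γ.tau k (x ⊗ₜ y) = y ⊗ₜ x := rfl

theorem sandwich_tmul (c c' x y z t : Γ.PathAlg k) :
    Γ.sandwich (c ⊗ₜ c') ((x ⊗ₜ y) ⊗ₜ (z ⊗ₜ t)) = (z * c * y) ⊗ₜ (x * c' * t) := by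
  simp [sandwich, tau]

theorem sandwich_add (c c' : Γ.PathAlg k ⊗[k] Γ.PathAlg k) :
    Γ.sandwich (c + c') = Γ.sandwich c + Γ.sandwich c' := by
  ext
  simp [sandwich, mul_add, add_mul]

theorem sandwich_smul (r : k) (c : Γ.PathAlg k ⊗[k] Γ.PathAlg k) :
    Γ.sandwich (r • c) = r • Γ.sandwich c := by
  ext
  simp [sandwich]

variable (Γ k) in
/-- `Γ.sandwich` as a linear map of both arguments. -/
noncomputable def sandwichHom : Γ.PathAlg k ⊗[k] Γ.PathAlg k →ₗ[k]
    (Γ.PathAlg k ⊗[k] Γ.PathAlg k) ⊗[k] (Γ.PathAlg k ⊗[k] Γ.PathAlg k) →ₗ[k]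
      Γ.PathAlg k ⊗[k] Γ.PathAlg k where
  toFun := Γ.sandwich
  map_add' := sandwich_add
  map_smul' := sandwich_smul

section LocalBrackets

/-- The contribution of a white vertex `v` with edges `x₁`, `x₂`, `x₃` to the bracket of two
edges. -/
noncomputable def whiteBracket (w : Weights k) (v : V) (x₁ x₂ x₃ : E) :
    E → E → Γ.PathAlg k ⊗[k] Γ.PathAlg k :=
  Γ.pairTerm x₁ x₂ (w.w₁₂ • Γ.arr k x₁ ⊗ₜ Γ.arr k x₂) +
    Γ.pairTerm x₁ x₃ (w.w₁₃ • (Γ.arr k x₃ * Γ.arr k x₁) ⊗ₜ Γ.idAt k (.inner v)) +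
    Γ.pairTerm x₂ x₃ (w.w₂₃ • (Γ.arr k x₃ * Γ.arr k x₂) ⊗ₜ Γ.idAt k (.inner v))

/-- The contribution of a black vertex `v` with edges `y₁`, `y₂`, `y₃` to the bracket of two
edges. -/
noncomputable def blackBracket (w : Weights k) (v : V) (y₁ y₂ y₃ : E) :
    E → E → Γ.PathAlg k ⊗[k] Γ.PathAlg k :=
  Γ.pairTerm y₁ y₂ (w.b₁₂ • Γ.arr k y₂ ⊗ₜ Γ.arr k y₁) +
    Γ.pairTerm y₁ y₃ (w.b₁₃ • Γ.idAt k (.inner v) ⊗ₜ (Γ.arr k y₁ * Γ.arr k y₃)) +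
    Γ.pairTerm y₂ y₃ (w.b₂₃ • Γ.idAt k (.inner v) ⊗ₜ (Γ.arr k y₂ * Γ.arr k y₃))

variable [Fintype E]

/-- The pairing with the double derivatives of `x` and `y` that extends a bracket of edges to the
bracket of `x` and `y`. -/
noncomputable def bracketPairing (x y : Γ.PathAlg k) :
    (E → E → Γ.PathAlg k ⊗[k] Γ.PathAlg k) →ₗ[k] Γ.PathAlg k ⊗[k] Γ.PathAlg k :=
  ∑ e, ∑ f, (Γ.sandwichHom k).flip (Γ.partialD k e x ⊗ₜ Γ.partialD k f y) ∘ₗ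
    LinearMap.proj f ∘ₗ LinearMap.proj e

theorem bracketPairing_apply (x y : Γ.PathAlg k) (c : E → E → Γ.PathAlg k ⊗[k] Γ.PathAlg k) :
    bracketPairing x y c =
      ∑ e, ∑ f, Γ.sandwich (c e f) (Γ.partialD k e x ⊗ₜ Γ.partialD k f y) := by
  simp only [bracketPairing, LinearMap.sum_apply]
  rfl

theorem bracketPairing_pairTerm (x y : Γ.PathAlg k) (a b : E)
    (c : Γ.PathAlg k ⊗[k] Γ.PathAlg k) :
    bracketPairing x y (Γ.pairTerm a b c) =
      Γ.sandwich c (Γ.partialD k a x ⊗ₜ Γ.partialD k b y) -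
        Γ.sandwich (Γ.tau k c) (Γ.partialD k b x ⊗ₜ Γ.partialD k a y) := by
  classical
  have hsingle (a b : E) (c : Γ.PathAlg k ⊗[k] Γ.PathAlg k) :
      bracketPairing x y (fun e f => if e = a ∧ f = b then c else 0) =
        Γ.sandwich c (Γ.partialD k a x ⊗ₜ Γ.partialD k b y) := by
    have hite (e f : E) : Γ.sandwich (if e = a ∧ f = b then c else 0)
        (Γ.partialD k e x ⊗ₜ Γ.partialD k f y) = if e = a then if f = b then
          Γ.sandwich c (Γ.partialD k e x ⊗ₜ Γ.partialD k f y) else 0 else 0 := by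
      rw [← ite_and]
      split_ifs
      · rfl
      · exact LinearMap.congr_fun (map_zero (Γ.sandwichHom k)) _
    simp only [bracketPairing_apply, hite, Finset.sum_ite_irrel, Finset.sum_const_zero,
      Finset.sum_ite_eq', Finset.mem_univ, if_true]
  rw [← hsingle a b c, ← hsingle b a, ← map_sub]
  rfl

open Classical in
theorem doubleBracket_eq_sum (w : Weights k) (x y : Γ.PathAlg k) :
    Γ.doubleBracket w x y = ∑ v, ∑ x₁, ∑ x₂, ∑ x₃,
      ((if Γ.IsWhite v x₁ x₂ x₃ then bracketPairing x y (whiteBracket w v x₁ x₂ x₃) else 0) +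
        if Γ.IsBlack v x₁ x₂ x₃ then bracketPairing x y (blackBracket w v x₁ x₂ x₃) else 0) := by
  have hedge : Γ.edgeBracket w = ∑ v, ∑ x₁, ∑ x₂, ∑ x₃,
      ((if Γ.IsWhite v x₁ x₂ x₃ then whiteBracket w v x₁ x₂ x₃ else 0) +
        if Γ.IsBlack v x₁ x₂ x₃ then blackBracket w v x₁ x₂ x₃ else 0) := by
    ext e f
    simp only [Finset.sum_apply, Pi.add_apply, ite_apply]
    rfl
  rw [doubleBracket, ← bracketPairing_apply, hedge]
  simp only [map_sum, map_add, apply_ite (bracketPairing x y), map_zero]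

end LocalBrackets

section Vertex

variable [Fintype E] (hP : Γ.IsPerfect) (hE : Γ.IsEmbedded) (hA : Γ.IsAcyclic) {z : k}
  (hz : z ≠ 0) {v : V} {x₁ x₂ x₃ : E} {a b : NetVertex m n V}

include hP hE hz

theorem IsWhite.pathSum_inner_right (h : Γ.IsWhite v x₁ x₂ x₃) (ha : a ≠ .inner v) :
    pathSum hA z a (.inner v) =
      z ^ Γ.index [x₃] • (pathSum hA z a (Γ.tail x₃) * Γ.arr k x₃) := by
  classical
  simp only [pathSum_eq_sum_head hA hz ha, h.head_eq hP hE, Finset.sum_filter,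
    Finset.sum_ite_eq', Finset.mem_univ, if_true]

theorem IsWhite.pathSum_inner_left (h : Γ.IsWhite v x₁ x₂ x₃) (hb : .inner v ≠ b) :
    pathSum hA z (.inner v) b =
      z ^ Γ.index [x₁] • (Γ.arr k x₁ * pathSum hA z (Γ.head x₁) b) +
        z ^ Γ.index [x₂] • (Γ.arr k x₂ * pathSum hA z (Γ.head x₂) b) := by
  classical
  simp only [pathSum_eq_sum_tail hA hz hb, h.tail_eq hP hE,
    sum_filter_eq_or_eq (h.ne hP hE), Finset.mem_univ, if_true]

theorem IsBlack.pathSum_inner_right (h : Γ.IsBlack v x₁ x₂ x₃) (ha : a ≠ .inner v) :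
    pathSum hA z a (.inner v) =
      z ^ Γ.index [x₁] • (pathSum hA z a (Γ.tail x₁) * Γ.arr k x₁) +
        z ^ Γ.index [x₂] • (pathSum hA z a (Γ.tail x₂) * Γ.arr k x₂) := by
  classical
  simp only [pathSum_eq_sum_head hA hz ha, h.head_eq hP hE,
    sum_filter_eq_or_eq (h.ne hP hE), Finset.mem_univ, if_true]

theorem IsBlack.pathSum_inner_left (h : Γ.IsBlack v x₁ x₂ x₃) (hb : .inner v ≠ b) :
    pathSum hA z (.inner v) b =
      z ^ Γ.index [x₃] • (Γ.arr k x₃ * pathSum hA z (Γ.head x₃) b) := by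
  classical
  simp only [pathSum_eq_sum_tail hA hz hb, h.tail_eq hP hE, Finset.sum_filter,
    Finset.sum_ite_eq', Finset.mem_univ, if_true]

end Vertex

section Measurements

variable {lam mu : k} (hlam : lam ≠ 0) (hmu : mu ≠ 0) (i i' : Fin m) (j j' : Fin n)

include hlam hmu

theorem sandwich_partialD_boundaryMeasurement [Finite E] (hA : Γ.IsAcyclic) (e f : E)
    (c c' : Γ.PathAlg k) :
    Γ.sandwich (c ⊗ₜ c') (Γ.partialD k e (Γ.boundaryMeasurement lam i' j) ⊗ₜ
        Γ.partialD k f (Γ.boundaryMeasurement mu i j')) =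
      (lam ^ Γ.index [e] * mu ^ Γ.index [f]) •
        (pathSum hA mu (.source i) (Γ.tail f) * c * pathSum hA lam (Γ.head e) (.sink j)) ⊗ₜ
          (pathSum hA lam (.source i') (Γ.tail e) * c' * pathSum hA mu (Γ.head f) (.sink j')) := by
  rw [partialD_boundaryMeasurement hA hlam, partialD_boundaryMeasurement hA hmu,
    TensorProduct.smul_tmul_smul, map_smul, sandwich_tmul]

variable [Fintype E] (hP : Γ.IsPerfect) (hE : Γ.IsEmbedded) (hA : Γ.IsAcyclic)
  (w : Weights k) {v : V} {x₁ x₂ x₃ : E}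

include hP hE hA

theorem IsWhite.bracketPairing_boundaryMeasurement (h : Γ.IsWhite v x₁ x₂ x₃) :
    bracketPairing (Γ.boundaryMeasurement lam i' j) (Γ.boundaryMeasurement mu i j')
        (whiteBracket w v x₁ x₂ x₃) =
      (w.w₁₂ + w.w₁₃ - w.w₂₃) •
        (Γ.sandwich (Γ.arr k x₁ ⊗ₜ Γ.arr k x₂)
            (Γ.partialD k x₁ (Γ.boundaryMeasurement lam i' j) ⊗ₜ
              Γ.partialD k x₂ (Γ.boundaryMeasurement mu i j')) -
          Γ.sandwich (Γ.arr k x₂ ⊗ₜ Γ.arr k x₁)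
            (Γ.partialD k x₂ (Γ.boundaryMeasurement lam i' j) ⊗ₜ
              Γ.partialD k x₁ (Γ.boundaryMeasurement mu i j'))) := by
  have hx₁ := (h.tail_eq hP hE).2 (.inl rfl)
  have hx₂ := (h.tail_eq hP hE).2 (.inr rfl)
  have hsrc (i : Fin m) : (.source i : NetVertex m n V) ≠ .inner v := nofun
  have hsink (j : Fin n) : (.inner v : NetVertex m n V) ≠ .sink j := nofun
  simp only [whiteBracket, map_add, bracketPairing_pairTerm, sandwich_smul, map_smul,
    LinearMap.smul_apply, tau_tmul, sandwich_partialD_boundaryMeasurement hlam hmu _ _ _ _ hA,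
    hx₁, hx₂, h.1, pathSum_mul_idAt]
  simp only [h.pathSum_inner_right hP hE hA hlam (hsrc _), h.pathSum_inner_left hP hE hA hlam
    (hsink _), h.pathSum_inner_right hP hE hA hmu (hsrc _), h.pathSum_inner_left hP hE hA hmu
    (hsink _), mul_add, smul_mul_assoc, mul_smul_comm, TensorProduct.tmul_add,
    TensorProduct.add_tmul, ← TensorProduct.smul_tmul', TensorProduct.tmul_smul, smul_smul,
    smul_add, mul_assoc]
  module

theorem IsBlack.bracketPairing_boundaryMeasurement (h : Γ.IsBlack v x₁ x₂ x₃) :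
    bracketPairing (Γ.boundaryMeasurement lam i' j) (Γ.boundaryMeasurement mu i j')
        (blackBracket w v x₁ x₂ x₃) =
      (w.b₁₂ + w.b₁₃ - w.b₂₃) •
        (Γ.sandwich (Γ.arr k x₂ ⊗ₜ Γ.arr k x₁)
            (Γ.partialD k x₁ (Γ.boundaryMeasurement lam i' j) ⊗ₜ
              Γ.partialD k x₂ (Γ.boundaryMeasurement mu i j')) -
          Γ.sandwich (Γ.arr k x₁ ⊗ₜ Γ.arr k x₂)
            (Γ.partialD k x₂ (Γ.boundaryMeasurement lam i' j) ⊗ₜ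
              Γ.partialD k x₁ (Γ.boundaryMeasurement mu i j'))) := by
  have hx₁ := (h.head_eq hP hE).2 (.inl rfl)
  have hx₂ := (h.head_eq hP hE).2 (.inr rfl)
  have hsrc (i : Fin m) : (.source i : NetVertex m n V) ≠ .inner v := nofun
  have hsink (j : Fin n) : (.inner v : NetVertex m n V) ≠ .sink j := nofun
  simp only [blackBracket, map_add, bracketPairing_pairTerm, sandwich_smul, map_smul,
    LinearMap.smul_apply, tau_tmul, sandwich_partialD_boundaryMeasurement hlam hmu _ _ _ _ hA,
    hx₁, hx₂, h.1, mul_assoc, idAt_mul_pathSum]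
  simp only [h.pathSum_inner_right hP hE hA hlam (hsrc _), h.pathSum_inner_left hP hE hA hlam
    (hsink _), h.pathSum_inner_right hP hE hA hmu (hsrc _), h.pathSum_inner_left hP hE hA hmu
    (hsink _), add_mul, smul_mul_assoc, mul_smul_comm, TensorProduct.tmul_add,
    TensorProduct.add_tmul, ← TensorProduct.smul_tmul', TensorProduct.tmul_smul, smul_smul,
    smul_add, mul_assoc]
  module

end Measurements

theorem sum_smul_tmul_sum_smul {R M N ι κ : Type*} [CommSemiring R] [AddCommMonoid M]
    [AddCommMonoid N] [Module R M] [Module R N] (s : Finset ι) (t : Finset κ) (f : ι → R)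
    (g : κ → R) (x : ι → M) (y : κ → N) :
    (∑ p ∈ s, f p • x p) ⊗ₜ[R] (∑ q ∈ t, g q • y q) =
      ∑ p ∈ s, ∑ q ∈ t, (f p * g q) • (x p ⊗ₜ y q) := by
  rw [TensorProduct.sum_tmul]
  simp only [TensorProduct.tmul_sum, TensorProduct.smul_tmul_smul]

section SwapSum

variable [Finite E] (hA : Γ.IsAcyclic) (lam mu : k) (i i' : Fin m) (j j' : Fin n)

open Classical in
/-- The generating function of the pairs of paths `p : i → j` through `e` and `q : i' → j'` through
`f`, where `e` and `f` meet at `a`. The weight is that of the paths `i → j'` and `i' → j` which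
result from exchanging at `a` the final parts of `p` and `q`, with spectral parameters `mu` and
`lam`. -/
noncomputable def swapSum (a : NetVertex m n V) (e f : E) : Γ.PathAlg k ⊗[k] Γ.PathAlg k :=
  ∑ p ∈ paths hA (.source i) (.sink j), ∑ q ∈ paths hA (.source i') (.sink j'),
    (if e ∈ p ∧ f ∈ q then
      crossWeight lam mu (Γ.index p) (Γ.index q) (Γ.indexTo p a - Γ.indexTo q a) else 0) •
        Γ.pathArr k (.source i) p ⊗ₜ Γ.pathArr k (.source i') q

variable {lam mu} {a : NetVertex m n V} {e f : E}

open Classical in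
theorem swapSum_eq_smul_tmul (r : k) (F G : List E → k)
    (hFG : ∀ p q, Γ.IsPath (.source i) p (.sink j) → Γ.IsPath (.source i') q (.sink j') →
      e ∈ p → f ∈ q → r * (F p * G q) =
        crossWeight lam mu (Γ.index p) (Γ.index q) (Γ.indexTo p a - Γ.indexTo q a)) :
    swapSum hA lam mu i i' j j' a e f =
      r • (∑ p ∈ paths hA (.source i) (.sink j),
          (if e ∈ p then F p else 0) • Γ.pathArr k (.source i) p) ⊗ₜ
        (∑ q ∈ paths hA (.source i') (.sink j'),
          (if f ∈ q then G q else 0) • Γ.pathArr k (.source i') q) := by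
  rw [sum_smul_tmul_sum_smul, Finset.smul_sum]
  refine Finset.sum_congr rfl fun p hp => ?_
  rw [Finset.smul_sum]
  refine Finset.sum_congr rfl fun q hq => ?_
  rw [smul_smul, ite_zero_mul_ite_zero, mul_ite, mul_zero]
  congr 1
  exact ite_congr rfl (fun h => (hFG p q ((mem_paths hA).1 hp) ((mem_paths hA).1 hq) h.1 h.2).symm)
    fun _ => rfl

variable (hlam : lam ≠ 0) (hmu : mu ≠ 0)

include hlam hmu

theorem sandwich_eq_swapSum_of_tail_eq (he : Γ.tail e = a) (hf : Γ.tail f = a) :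
    Γ.sandwich (Γ.arr k e ⊗ₜ Γ.arr k f)
        (Γ.partialD k e (Γ.boundaryMeasurement lam i' j) ⊗ₜ
          Γ.partialD k f (Γ.boundaryMeasurement mu i j')) =
      swapSum hA lam mu i i' j j' a e f := by
  rw [sandwich_partialD_boundaryMeasurement hlam hmu i i' j j' hA, hf, ← he,
    pathSum_mul_arr_mul_pathSum, he, ← hf, pathSum_mul_arr_mul_pathSum]
  refine (swapSum_eq_smul_tmul hA i i' j j' _ _ _ fun p q hp hq hep hfq => ?_).symm
  rw [hp.indexTo_head hA hep, hq.indexTo_head hA hfq, he, hf, crossWeight]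
  simp only [zpow_sub₀ hlam, zpow_add₀ hlam, zpow_add₀ hmu, zpow_sub₀ hmu]
  field_simp

theorem sandwich_eq_swapSum_of_head_eq (he : Γ.head e = a) (hf : Γ.head f = a) :
    Γ.sandwich (Γ.arr k f ⊗ₜ Γ.arr k e)
        (Γ.partialD k e (Γ.boundaryMeasurement lam i' j) ⊗ₜ
          Γ.partialD k f (Γ.boundaryMeasurement mu i j')) =
      swapSum hA lam mu i i' j j' a f e := by
  rw [sandwich_partialD_boundaryMeasurement hlam hmu i i' j j' hA, he, ← hf,
    pathSum_mul_arr_mul_pathSum, hf, ← he, pathSum_mul_arr_mul_pathSum]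
  refine (swapSum_eq_smul_tmul hA i i' j j' _ _ _ fun p q hp hq hfp heq => ?_).symm
  have hfa : Γ.indexTo p a = Γ.indexTo p (Γ.tail f) + Γ.index [f] := by
    rw [← hf, hp.indexTo_head hA hfp]
  have hea : Γ.indexTo q a = Γ.indexTo q (Γ.tail e) + Γ.index [e] := by
    rw [← he, hq.indexTo_head hA heq]
  rw [he, hfa, hea, crossWeight]
  simp only [zpow_sub₀ hlam, zpow_add₀ hlam, zpow_add₀ hmu, zpow_sub₀ hmu]
  field_simp

end SwapSum

end Bracket

section Main

variable {m n : ℕ} {V E : Type*} {Γ : CylNetwork m n V E} {k : Type*} [Field k] [Fintype V]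

theorem half_smul_swapSum_sub_swapSum [Finite E] (hA : Γ.IsAcyclic) (lam mu : k) (i i' : Fin m)
    (j j' : Fin n) (a : NetVertex m n V) (e f : E) :
    (1 / 2 : k) • (swapSum hA lam mu i i' j j' a e f - swapSum hA lam mu i i' j j' a f e) =
      ∑ p ∈ paths hA (.source i) (.sink j), ∑ q ∈ paths hA (.source i') (.sink j'),
        (1 / 2 * (crossing p q e f * crossWeight lam mu (Γ.index p) (Γ.index q)
          (Γ.indexTo p a - Γ.indexTo q a))) •
            Γ.pathArr k (.source i) p ⊗ₜ Γ.pathArr k (.source i') q := by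
  simp only [swapSum, ← Finset.sum_sub_distrib, Finset.smul_sum, ← sub_smul, smul_smul, crossing]
  refine Finset.sum_congr rfl fun p _ => Finset.sum_congr rfl fun q _ => ?_
  congr 2
  push_cast
  rw [sub_mul, ite_zero_mul, ite_zero_mul, one_mul]

variable [Fintype E] {w : Weights k} {lam mu : k}

theorem IsPerfectCylindrical.doubleBracket_boundaryMeasurement_eq_sum
    (hΓ : Γ.IsPerfectCylindrical) (hw : w.IsStandard) (hlam : lam ≠ 0) (hmu : mu ≠ 0)
    (i i' : Fin m) (j j' : Fin n) :
    Γ.doubleBracket w (Γ.boundaryMeasurement lam i' j) (Γ.boundaryMeasurement mu i j') =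
      ∑ p ∈ paths hΓ.acyclic (.source i) (.sink j),
        ∑ q ∈ paths hΓ.acyclic (.source i') (.sink j'),
          (∑ v, 1 / 2 * (Γ.crossingAt p q v * crossWeight lam mu (Γ.index p) (Γ.index q)
            (Γ.indexTo p (.inner v) - Γ.indexTo q (.inner v)))) •
              Γ.pathArr k (.source i) p ⊗ₜ Γ.pathArr k (.source i') q := by
  have hP := hΓ.perfect
  have hE := hΓ.embedded
  have hA := hΓ.acyclic
  simp only [Finset.sum_smul (s := (Finset.univ : Finset V))]
  rw [Finset.sum_congr rfl fun p _ => Finset.sum_comm, Finset.sum_comm, doubleBracket_eq_sum]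
  refine Finset.sum_congr rfl fun v _ => ?_
  rcases hP.isWhite_or_isBlack hE v with ⟨x₁, x₂, x₃, h⟩ | ⟨x₁, x₂, x₃, h⟩
  · have hx₁ := (h.tail_eq hP hE).2 (.inl rfl)
    have hx₂ := (h.tail_eq hP hE).2 (.inr rfl)
    simp only [h.crossingAt_eq hP hE]
    rw [h.sum_eq hP hE, h.bracketPairing_boundaryMeasurement hlam hmu i i' j j' hP hE hA, hw.1,
      sandwich_eq_swapSum_of_tail_eq hA i i' j j' hlam hmu hx₁ hx₂,
      sandwich_eq_swapSum_of_tail_eq hA i i' j j' hlam hmu hx₂ hx₁,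
      half_smul_swapSum_sub_swapSum]
  · have hx₁ := (h.head_eq hP hE).2 (.inl rfl)
    have hx₂ := (h.head_eq hP hE).2 (.inr rfl)
    simp only [h.crossingAt_eq hP hE]
    rw [h.sum_eq hP hE, h.bracketPairing_boundaryMeasurement hlam hmu i i' j j' hP hE hA, hw.2,
      sandwich_eq_swapSum_of_head_eq hA i i' j j' hlam hmu hx₁ hx₂,
      sandwich_eq_swapSum_of_head_eq hA i i' j j' hlam hmu hx₂ hx₁,
      neg_smul, ← smul_neg, neg_sub, half_smul_swapSum_sub_swapSum]

theorem IsPerfectCylindrical.doubleBracket_boundaryMeasurement [NeZero (2 : k)]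
    (hΓ : Γ.IsPerfectCylindrical) (hw : w.IsStandard) (hlam : lam ≠ 0) (hmu : mu ≠ 0)
    (hne : lam ≠ mu) (i i' : Fin m) (j j' : Fin n) :
    Γ.doubleBracket w (Γ.boundaryMeasurement lam i' j) (Γ.boundaryMeasurement mu i j') =
      trigCoeff lam mu i' i •
          (Γ.boundaryMeasurement lam i j ⊗ₜ Γ.boundaryMeasurement mu i' j') -
        trigCoeff lam mu j' j •
          (Γ.boundaryMeasurement mu i j ⊗ₜ Γ.boundaryMeasurement lam i' j') := by
  rw [hΓ.doubleBracket_boundaryMeasurement_eq_sum hw hlam hmu]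
  simp only [boundaryMeasurement_eq_pathSum hΓ.acyclic, pathSum, sum_smul_tmul_sum_smul,
    Finset.smul_sum, smul_smul, ← Finset.sum_sub_distrib, ← sub_smul]
  refine Finset.sum_congr rfl fun p hp => Finset.sum_congr rfl fun q hq => ?_
  rw [hΓ.sum_crossingAt hlam hmu hne ((mem_paths _).1 hp) ((mem_paths _).1 hq)]

end Main

/-! ### Matrix form -/

section Matrices

variable {m n : ℕ} {V E : Type*} {Γ : CylNetwork m n V E} {k : Type*} [Field k] [Fintype V]

open scoped Kronecker in
theorem leftMat_kronecker_rightMat_apply {I J I' J' : Type*} (X : Matrix I J (Γ.PathAlg k))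
    (Y : Matrix I' J' (Γ.PathAlg k)) (p : I × I') (q : J × J') :
    (Γ.leftMat X ⊗ₖ Γ.rightMat Y) p q = X p.1 q.1 ⊗ₜ Y p.2 q.2 := by
  simp [leftMat, rightMat, Matrix.kroneckerMap_apply]

open scoped Kronecker in
theorem trigRMatrix_eq_sum (n : ℕ) (lam mu : k) : trigRMatrix n lam mu =
    ∑ i : Fin n, ∑ j : Fin n,
      trigCoeff lam mu i j • Matrix.single i j (1 : k) ⊗ₖ Matrix.single j i (1 : k) := by
  have hdiag : ∑ a : Fin n, Matrix.single a a (1 : k) ⊗ₖ Matrix.single a a (1 : k) =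
      ∑ i : Fin n, ∑ j : Fin n,
        if i = j then Matrix.single i j (1 : k) ⊗ₖ Matrix.single j i (1 : k) else 0 := by
    simp only [Finset.sum_ite_eq, Finset.mem_univ, if_true]
  rw [trigRMatrix, hdiag]
  simp only [ite_add_zero, Finset.sum_add_distrib]
  rw [Finset.sum_comm (f := fun i j : Fin n => if i < j then
    mu • Matrix.single j i (1 : k) ⊗ₖ Matrix.single i j (1 : k) else 0)]
  simp only [← Finset.sum_add_distrib, Finset.smul_sum]
  refine Finset.sum_congr rfl fun i _ => Finset.sum_congr rfl fun j _ => ?_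
  unfold trigCoeff
  rcases lt_trichotomy i j with h | rfl | h
  · simp [h, h.ne, h.not_gt, smul_smul, div_eq_inv_mul]
  · simp
  · simp [h, h.ne', h.not_gt, smul_smul, div_eq_inv_mul]

theorem trigRMatrix_apply (n : ℕ) (lam mu : k) (p q : Fin n × Fin n) :
    trigRMatrix n lam mu p q = if q.1 = p.2 ∧ q.2 = p.1 then trigCoeff lam mu p.1 p.2 else 0 := by
  obtain ⟨a, b⟩ := p
  obtain ⟨c, d⟩ := q
  simp only [trigRMatrix_eq_sum, Matrix.sum_apply, Matrix.smul_apply,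
    Matrix.single_kronecker_single, Matrix.single_apply, Prod.mk.injEq]
  simp only [and_assoc, ite_and, smul_ite, smul_zero, Finset.sum_ite_irrel, Finset.sum_const_zero,
    Finset.sum_ite_eq', Finset.mem_univ, if_true]
  simp only [smul_eq_mul, mul_one, eq_comm (a := b), eq_comm (a := a)]

open scoped Kronecker in
theorem scalarMat_trigRMatrix_mul_apply (lam mu : k) (X Y : Matrix (Fin m) (Fin n) (Γ.PathAlg k))
    (p : Fin m × Fin m) (q : Fin n × Fin n) :
    (Γ.scalarMat (trigRMatrix m lam mu) * (Γ.leftMat X ⊗ₖ Γ.rightMat Y)) p q =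
      trigCoeff lam mu p.1 p.2 • (X p.2 q.1 ⊗ₜ Y p.1 q.2) := by
  simp only [Matrix.mul_apply, scalarMat, Matrix.map_apply, ← Algebra.smul_def, trigRMatrix_apply,
    leftMat_kronecker_rightMat_apply, Fintype.sum_prod_type, ite_and, ite_smul, zero_smul,
    Finset.sum_ite_irrel, Finset.sum_const_zero, Finset.sum_ite_eq', Finset.mem_univ, if_true]

open scoped Kronecker in
theorem tauMat_mul_scalarMat_trigRMatrix_apply (lam mu : k)
    (X Y : Matrix (Fin m) (Fin n) (Γ.PathAlg k)) (p : Fin m × Fin m) (q : Fin n × Fin n) :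
    Γ.tauMat ((Γ.leftMat X ⊗ₖ Γ.rightMat Y) * Γ.scalarMat (trigRMatrix n lam mu)) p q =
      trigCoeff lam mu q.2 q.1 • (Y p.2 q.1 ⊗ₜ X p.1 q.2) := by
  simp only [tauMat, Matrix.mul_apply, scalarMat, Matrix.map_apply, ← Algebra.commutes,
    ← Algebra.smul_def, trigRMatrix_apply, leftMat_kronecker_rightMat_apply,
    Fintype.sum_prod_type, ite_and, ite_smul, zero_smul, Finset.sum_ite_eq,
    Finset.mem_univ, if_true, map_smul, tau_tmul]

end Matrices

end CylNetwork

theorem specLam_ne_zero : specLam ≠ 0 :=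
  (FaithfulSMul.algebraMap_eq_zero_iff _ _).not.2 (MvPolynomial.X_ne_zero 0)

theorem specMu_ne_zero : specMu ≠ 0 :=
  (FaithfulSMul.algebraMap_eq_zero_iff _ _).not.2 (MvPolynomial.X_ne_zero 1)

theorem specLam_ne_specMu : specLam ≠ specMu :=
  (FaithfulSMul.algebraMap_injective (MvPolynomial (Fin 2) ℂ) SpectralField).ne
    (MvPolynomial.X_injective.ne zero_ne_one)

open CylNetwork in
open scoped Kronecker in
theorem mainTheorem2_general {k : Type*} [Field k] [NeZero (2 : k)] {m n : ℕ} {V E : Type*}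
    [Fintype V] [Fintype E] {Γ : CylNetwork m n V E} {w : Weights k} {lam mu : k}
    (hΓ : Γ.IsPerfectCylindrical) (hw : w.IsStandard) (hlam : lam ≠ 0) (hmu : mu ≠ 0)
    (hne : lam ≠ mu) :
    Γ.matrixBracket w (Γ.boundaryMeasurement lam) (Γ.boundaryMeasurement mu) =
      Γ.scalarMat (trigRMatrix m lam mu) *
          (Γ.leftMat (Γ.boundaryMeasurement lam) ⊗ₖ Γ.rightMat (Γ.boundaryMeasurement mu)) -
        Γ.tauMat ((Γ.leftMat (Γ.boundaryMeasurement lam) ⊗ₖ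
          Γ.rightMat (Γ.boundaryMeasurement mu)) * Γ.scalarMat (trigRMatrix n lam mu)) := by
  ext ⟨i', i⟩ ⟨j, j'⟩
  rw [Matrix.sub_apply, scalarMat_trigRMatrix_mul_apply, tauMat_mul_scalarMat_trigRMatrix_apply]
  exact hΓ.doubleBracket_boundaryMeasurement hw hlam hmu hne i i' j j'

open CylNetwork in
open scoped Kronecker in
theorem mainTheorem2 :
    (∀ (m n : ℕ) (V E : Type) [Fintype V] [Fintype E] (Γ : CylNetwork m n V E)
      (w : Weights SpectralField), Γ.IsPerfectCylindrical → w.IsStandard →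
      Γ.matrixBracket w (Γ.boundaryMeasurement specLam) (Γ.boundaryMeasurement specMu) =
        Γ.scalarMat (trigRMatrix m specLam specMu) *
            (Γ.leftMat (Γ.boundaryMeasurement specLam) ⊗ₖ
              Γ.rightMat (Γ.boundaryMeasurement specMu)) -
          Γ.tauMat
            ((Γ.leftMat (Γ.boundaryMeasurement specLam) ⊗ₖ
              Γ.rightMat (Γ.boundaryMeasurement specMu)) *
              Γ.scalarMat (trigRMatrix n specLam specMu))) ∧
    (∀ (n : ℕ) (V E : Type) [Fintype V] [Fintype E] (Γ : CylNetwork n n V E)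
      (w : Weights SpectralField), Γ.IsPerfectCylindrical → w.IsStandard →
      Γ.matrixBracket w (Γ.boundaryMeasurement specLam) (Γ.boundaryMeasurement specMu) =
        Γ.twistedCommutator (Γ.scalarMat (trigRMatrix n specLam specMu))
          (Γ.leftMat (Γ.boundaryMeasurement specLam) ⊗ₖ
            Γ.rightMat (Γ.boundaryMeasurement specMu))) := by
  have hbracket {m n : ℕ} {V E : Type} [Fintype V] [Fintype E] {Γ : CylNetwork m n V E}
      {w : Weights SpectralField} (hΓ : Γ.IsPerfectCylindrical) (hw : w.IsStandard) :=
    mainTheorem2_general hΓ hw specLam_ne_zero specMu_ne_zero specLam_ne_specMu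
  exact ⟨fun _ _ _ _ _ _ _ _ => hbracket, fun _ _ _ _ _ _ _ => hbracket⟩
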